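/- Let $K\ge 3$, let $\mathcal A=\{1,\dots,K\}$ be a set of arms and let $\mathcal S$ be a finite set. Let $P_1\ne P_2$ be the transition probability matrices of two ergodic (irreducible, aperiodic) Markov chains on $\mathcal S$ such that, for all $i,j\in\mathcal S$, $P_1(j|i)>0$ if and only if $P_2(j|i)>0$. Each arm carries a Markov chain on $\mathcal S$; the chains are independent, they all make one step at every time instant whether or not they are observed, and the initial state of arm $a$ has a law $\rho_a$ that does not depend on which arm is odd. Under the hypothesis $\mathcal H_h$ ($h\in\mathcal A$ is the odd arm) arm $h$ has transition matrix $P_h^h=P_1$ and every arm $a\ne h$ has transition matrix $P_h^a=P_2$. Let $\eta\in(0,1]$. At the times $t=0,\dots,K-1$ arm $t+1$ is pulled and observed. At each time $t\ge K$ a policy $\pi$, on the basis of the history of the intended arms, pulled arms and observed states $(B_s,A_s,\bar X_s)_{s<t}$, either selects an intended arm $B_t$, by a deterministic or randomised rule, or stops and declares an index $\theta(\pi)$ (possibly randomised) as the odd arm. If it does not stop, arm $a$ is actually pulled, $A_t=a$, with probability $\frac{\eta}{K}+(1-\eta)\mathbb 1_{\{B_t=a\}}$, and the state $\bar X_t$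 of arm $A_t$ at time $t$ is observed. Let $\tau(\pi)\in\{K,K+1,\dots\}\cup\{\infty\}$ be the time at which $\pi$ stops, let $P_h$, $E_h$ be probability and expectation under $\mathcal H_h$ and $\pi$, and let $\Pi(\epsilon)$ be the set of all policies with $P_h(\tau(\pi)<\infty,\ \theta(\pi)\ne h)\le\epsilon$ for every $h\in\mathcal A$. Let $\mathbb S$ be the set of all $(\underline d,\underline i)\in\{1,2,\dots\}^K\times\mathcal S^K$ for which exactly one component of $\underline d$ equals $1$. Fix $h\in\mathcal A$. For $a\in\mathcal A$ let $Q(\underline d',\underline i'|\underline d,\underline i,a)=(P_h^a)^{d_a}(i'_a|i_a)$ if $d'_a=1$ and $d'_c=d_c+1$, $i'_c=i_c$ for all $c\ne a$, and $Q(\underline d',\underline i'|\underline d,\underline i,a)=0$ otherwise. For a stationary randomised strategy $\lambda$, that is, a family of probability distributions $\lambda(\cdot|\underline d,\underline i)$ on $\mathcal A$ indexed by $(\underline d,\underline i)\in\mathbb S$, let $\mu^\lambda$ be the stationary distribution of the Markov chain on $\mathbb S$ with transition probabilities $\sum_{a}\big(\frac{\eta}{K}+(1-\eta)\lambda(a|\underline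 d,\underline i)\big)Q(\underline d',\underline i'|\underline d,\underline i,a)$, and let $$\nu^\lambda(\underline d,\underline i,a)=\mu^\lambda(\underline d,\underline i)\Big(\frac{\eta}{K}+(1-\eta)\lambda(a|\underline d,\underline i)\Big).$$ With $D(\mu\|\nu)=\sum_{j\in\mathcal S}\mu(j)\log\frac{\mu(j)}{\nu(j)}$ ($0\log\frac00=0$), for $h'\ne h$ let $k_{hh'}(\underline d,\underline i,a)$ be $D(P_1^{d_a}(\cdot|i_a)\|P_2^{d_a}(\cdot|i_a))$ if $a=h$, $D(P_2^{d_a}(\cdot|i_a)\|P_1^{d_a}(\cdot|i_a))$ if $a=h'$, and $0$ otherwise. Put $$R^*(P_1,P_2)=\sup_{\lambda}\ \min_{h'\ne h}\ \sum_{(\underline d,\underline i)\in\mathbb S}\ \sum_{a=1}^K\nu^\lambda(\underline d,\underline i,a)\,k_{hh'}(\underline d,\underline i,a),$$ the supremum being over all stationary randomised strategies. Then $$\liminf_{\epsilon\downarrow0}\ \inf_{\pi\in\Pi(\epsilon)}\frac{E_h[\tau(\pi)]}{\log(1/\epsilon)}\ \ge\ \frac1{R^*(P_1,P_2)}.$$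 -/

import Mathlib

open scoped ENNReal Topology

noncomputable section

namespace OddArm

/-! ### Transition matrices -/

section Chains

variable {S : Type*}

/-- A Markov transition law on `S` is a map `P : S → PMF S`, where `P i j` is the probability
`P(j|i)`. This is its transition probability matrix, with `(i, j)` entry `P(j|i)`. -/
def transMatrix (P : S → PMF S) : Matrix S S ℝ :=
  Matrix.of fun i j => (P i j).toReal

variable [Fintype S] [DecidableEq S]

/-- The `d`-step transition probability `P^d(j|i)`. -/
def stepProb (P : S → PMF S) (d : ℕ) (i j : S) : ℝ :=
  (transMatrix P ^ d) i j

/-- A finite-state chain is ergodic when it is irreducible and aperiodic (for every state, the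
greatest common divisor of the possible return times is one). -/
def IsErgodicChain (P : S → PMF S) : Prop :=
  (transMatrix P).IsIrreducible ∧
    ∀ i : S, ∀ g : ℕ, (∀ n : ℕ, 1 ≤ n → 0 < stepProb P n i i → g ∣ n) → g = 1

/-- The Kullback--Leibler divergence `∑ p(i) log (p(i)/q(i))` of two distributions on a finite set,
with `0 log (0/0) = 0`. It is used only where `q(i) = 0` implies `p(i) = 0`. -/
def klFin (p q : S → ℝ) : ℝ :=
  ∑ i, p i * Real.log (p i / q i)

end Chains

/-! ### The observed process of a policy -/

/-- What a policy prescribes after a history: pull an arm drawn from the given distribution, or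
stop and declare an index drawn from the given distribution as the odd arm. A deterministic choice
is a point mass. -/
inductive Action (K : ℕ) where
  | pull (p : PMF (Fin K)) : Action K
  | halt (p : PMF (Fin K)) : Action K

/-- The distribution of the index that the action draws. -/
def Action.dist {K : ℕ} : Action K → PMF (Fin K)
  | .pull p => p
  | .halt p => p

/-- Whether the action is to stop. -/
def Action.IsStop {K : ℕ} : Action K → Prop
  | .pull _ => False
  | .halt _ => True

/-- What the decision maker sees at one time: the intended arm `B`, the arm `A` that is actually
pulled, and the observed state of the arm `A`. -/
abbrev Obs (K : ℕ) (S : Type*) := Fin K × Fin K × S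

/-- A policy maps each history `(B^{t-1}, A^{t-1}, X̄^{t-1})` to an action for time `t`. Its
prescriptions at the times `t < K` are ignored, as the arms are then pulled in order. -/
abbrev Policy (K : ℕ) (S : Type*) := (t : ℕ) → (Fin t → Obs K S) → Action K

/-- The complete record of one time instant: the states of all the arms (of which only that of the
pulled arm is observed), the intended arm (at the time of stopping: the declared index), and the
arm actually pulled. -/
structure Rec (K : ℕ) (S : Type*) where
  /-- the current states of all the arms -/
  state : Fin K → S
  /-- the index drawn by the policy -/
  intended : Fin K
  /-- the arm that is pulled -/
  pulled : Fin K

namespace Rec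

variable {K : ℕ} {S : Type*}

instance : MeasurableSpace (Rec K S) := ⊤

instance : DiscreteMeasurableSpace (Rec K S) := ⟨fun _ => trivial⟩

instance [Finite S] : Finite (Rec K S) :=
  Finite.of_injective (fun r : Rec K S => (r.state, r.intended, r.pulled)) (by
    rintro ⟨x, b, a⟩ ⟨y, c, e⟩ h
    simp only [Prod.mk.injEq] at h
    obtain ⟨rfl, rfl, rfl⟩ := h
    rfl)

/-- The part of the record that the decision maker sees. -/
def obs (r : Rec K S) : Obs K S := (r.intended, r.pulled, r.state r.pulled)

end Rec

section Law

variable {K : ℕ} {S : Type*} [Fintype S]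

/-- The joint law of independent `S`-valued random variables with laws `p c`, `c : Fin K`. -/
def productLaw (p : Fin K → PMF S) : PMF (Fin K → S) :=
  PMF.ofFintype (fun x => ∏ c, p c (x c)) (by
    have h : ∀ c, ∑ j, p c j = 1 := fun c => by rw [← tsum_fintype (L := .unconditional _), (p c).tsum_coe]
    have h2 := Finset.prod_univ_sum (fun _ : Fin K => (Finset.univ : Finset S)) (fun c j => p c j)
    rw [Fintype.piFinset_univ] at h2
    rw [← h2]
    simp [h])

/-- The trembling hand: the probability that arm `a` is pulled when arm `b` is intended. -/
def trembleProb (K : ℕ) (η : Set.Ioc (0 : ℝ) 1) (b a : Fin K) : ℝ :=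
  (η : ℝ) / K + (1 - (η : ℝ)) * (if a = b then 1 else 0)

lemma trembleProb_nonneg (η : Set.Ioc (0 : ℝ) 1) (b a : Fin K) : 0 ≤ trembleProb K η b a := by
  have h0 := η.2.1.le
  have h1 : (0 : ℝ) ≤ 1 - η := sub_nonneg.2 η.2.2
  unfold trembleProb
  split_ifs <;> positivity

lemma sum_trembleProb (η : Set.Ioc (0 : ℝ) 1) (b : Fin K) : ∑ a, trembleProb K η b a = 1 := by
  have hK : (K : ℝ) ≠ 0 := by
    have := b.pos
    positivity
  simp only [trembleProb, Finset.sum_add_distrib, ← Finset.mul_sum]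
  simp
  field_simp
  ring

/-- The law of the arm that is actually pulled when arm `b` is intended. -/
def tremble (η : Set.Ioc (0 : ℝ) 1) (b : Fin K) : PMF (Fin K) :=
  PMF.ofFintype (fun a => ENNReal.ofReal (trembleProb K η b a)) (by
    rw [← ENNReal.ofReal_sum_of_nonneg fun a _ => trembleProb_nonneg η b a, sum_trembleProb,
      ENNReal.ofReal_one])

/-- The joint law of the intended and the pulled arm at time `t` after a given history. The arms
are pulled in order at the times `0, …, K - 1`; from then on the policy and the trembling hand
decide. -/
def controlLaw (η : Set.Ioc (0 : ℝ) 1) (π : Policy K S) (t : ℕ) (hist : Fin t → Obs K S) :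
    PMF (Fin K × Fin K) :=
  if ht : t < K then PMF.pure (⟨t, ht⟩, ⟨t, ht⟩)
  else (π t hist).dist.bind fun b => (tremble η b).map fun a => (b, a)

/-- The law of the record at time `t`, given the history and given the laws of the current states
of the arms; the states of the arms are independent of each other and of the control. -/
def recLaw (η : Set.Ioc (0 : ℝ) 1) (π : Policy K S) (t : ℕ) (hist : Fin t → Obs K S)
    (p : Fin K → PMF S) : PMF (Rec K S) :=
  (productLaw p).bind fun x => (controlLaw η π t hist).map fun c => ⟨x, c.1, c.2⟩

/-- The transition law of arm `a` under the hypothesis that `h` is the odd arm. -/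
def armLaw (P₁ P₂ : S → PMF S) (h a : Fin K) : S → PMF S :=
  if a = h then P₁ else P₂

/-- Given the records up to time `n`, the law of the record at time `n + 1`: every arm, pulled or
not, makes one step of its own chain. -/
def stepKernel (η : Set.Ioc (0 : ℝ) 1) (P₁ P₂ : S → PMF S) (h : Fin K) (π : Policy K S) (n : ℕ) :
    ProbabilityTheory.Kernel ((i : Finset.Iic n) → Rec K S) (Rec K S) where
  toFun ω := (recLaw η π (n + 1)
    (fun t => (ω ⟨t, Finset.mem_Iic.2 (Nat.lt_succ_iff.1 t.2)⟩).obs)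
    (fun c => armLaw P₁ P₂ h c ((ω ⟨n, Finset.mem_Iic.2 le_rfl⟩).state c))).toMeasure
  measurable' := Measurable.of_discrete

instance (η : Set.Ioc (0 : ℝ) 1) (P₁ P₂ : S → PMF S) (h : Fin K) (π : Policy K S) (n : ℕ) :
    ProbabilityTheory.IsMarkovKernel (stepKernel η P₁ P₂ h π n) :=
  ⟨fun ω => by dsimp only [stepKernel, ProbabilityTheory.Kernel.coe_mk]; infer_instance⟩

/-- `P_h^π`: the law of the whole sequence of records under the policy `π` when `h` is the odd arm
and arm `a` starts at time `0` in a state with law `ρ a`, independently of the other arms. -/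
def trajLaw (η : Set.Ioc (0 : ℝ) 1) (P₁ P₂ : S → PMF S) (ρ : Fin K → PMF S) (h : Fin K)
    (π : Policy K S) : MeasureTheory.Measure (ℕ → Rec K S) :=
  ProbabilityTheory.Kernel.trajMeasure (X := fun _ => Rec K S)
    (recLaw η π 0 Fin.elim0 ρ).toMeasure (stepKernel η P₁ P₂ h π)

/-- The stopping time `τ(π)`: the first time `t ≥ K` at which the policy prescribes to stop. -/
def stopTime (π : Policy K S) (ω : ℕ → Rec K S) : ℕ∞ :=
  ⨅ (t : ℕ) (_ : K ≤ t ∧ (π t fun s => (ω s).obs).IsStop), (t : ℕ∞)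

/-- The expected stopping time `E_h[τ(π)]`. -/
def expStopTime (η : Set.Ioc (0 : ℝ) 1) (P₁ P₂ : S → PMF S) (ρ : Fin K → PMF S) (h : Fin K)
    (π : Policy K S) : ℝ≥0∞ :=
  ∫⁻ ω, (stopTime π ω : ℝ≥0∞) ∂(trajLaw η P₁ P₂ ρ h π)

/-- The error probability `P_h(θ(π) ≠ h)`: the policy stops and declares an index other than `h`. -/
def errorProb (η : Set.Ioc (0 : ℝ) 1) (P₁ P₂ : S → PMF S) (ρ : Fin K → PMF S) (h : Fin K)
    (π : Policy K S) : ℝ≥0∞ :=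
  trajLaw η P₁ P₂ ρ h π {ω | ∃ t : ℕ, stopTime π ω = t ∧ (ω t).intended ≠ h}

/-- `Π(ε)`: the policies whose error probability is at most `ε` for every odd arm location. -/
def goodPolicies (η : Set.Ioc (0 : ℝ) 1) (P₁ P₂ : S → PMF S) (ρ : Fin K → PMF S) (ε : ℝ) :
    Set (Policy K S) :=
  {π | ∀ h : Fin K, errorProb η P₁ P₂ ρ h π ≤ ENNReal.ofReal ε}

end Law

/-! ### The chain of delays and last observed states, and the constant `R*` -/

/-- The state space of the delays `d_a` and last observed states `i_a` of the arms: all delays are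
positive and exactly one of them equals `1`. -/
structure DState (K : ℕ) (S : Type*) where
  /-- the delays of the arms -/
  delay : Fin K → ℕ
  /-- the last observed states of the arms -/
  last : Fin K → S
  one_le_delay : ∀ a, 1 ≤ delay a
  existsUnique_delay_eq_one : ∃! a, delay a = 1

section Rate

variable {K : ℕ} {S : Type*} [Fintype S] [DecidableEq S]

open scoped Classical in
/-- `Q(d', i' | d, i, a)`: the transition probabilities when arm `a` is actually pulled and `h` is
the odd arm. -/
def pullTrans (P₁ P₂ : S → PMF S) (h : Fin K) (s : DState K S) (a : Fin K) (s' : DState K S) :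
    ℝ≥0∞ :=
  if s'.delay a = 1 ∧ ∀ c, c ≠ a → s'.delay c = s.delay c + 1 ∧ s'.last c = s.last c then
    ENNReal.ofReal (stepProb (armLaw P₁ P₂ h a) (s.delay a) (s.last a) (s'.last a))
  else 0

/-- A stationary randomised strategy `λ(· | d, i)`. -/
abbrev SRS (K : ℕ) (S : Type*) := DState K S → PMF (Fin K)

/-- The probability `η / K + (1 - η) λ(a | d, i)` that arm `a` is actually pulled. -/
def pullProb (η : Set.Ioc (0 : ℝ) 1) (lam : SRS K S) (s : DState K S) (a : Fin K) : ℝ≥0∞ :=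
  ENNReal.ofReal ((η : ℝ) / K) + ENNReal.ofReal (1 - η) * lam s a

/-- `μ` is a stationary distribution of the chain of delays and last observed states under the
strategy `lam`, when `h` is the odd arm. -/
def IsStationary (η : Set.Ioc (0 : ℝ) 1) (P₁ P₂ : S → PMF S) (h : Fin K) (lam : SRS K S)
    (μ : PMF (DState K S)) : Prop :=
  ∀ s', ∑' s, ∑ a, μ s * pullProb η lam s a * pullTrans P₁ P₂ h s a s' = μ s'

open scoped Classical in
/-- The stationary distribution `μ^λ` of the chain of delays and last observed states (which
exists and is unique for ergodic arms; the default value `0` would only make `R*` smaller). -/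
def stationaryDist (η : Set.Ioc (0 : ℝ) 1) (P₁ P₂ : S → PMF S) (h : Fin K) (lam : SRS K S) :
    DState K S → ℝ≥0∞ :=
  if hex : ∃ μ : PMF (DState K S), IsStationary η P₁ P₂ h lam μ then ⇑hex.choose else 0

/-- The ergodic state--action occupancy measure `ν^λ(d, i, a)`. -/
def occupancy (η : Set.Ioc (0 : ℝ) 1) (P₁ P₂ : S → PMF S) (h : Fin K) (lam : SRS K S)
    (s : DState K S) (a : Fin K) : ℝ≥0∞ :=
  stationaryDist η P₁ P₂ h lam s * pullProb η lam s a

/-- `k_{hh'}(d, i, a)`. -/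
def kDiv (P₁ P₂ : S → PMF S) (h h' : Fin K) (s : DState K S) (a : Fin K) : ℝ :=
  if a = h then
    klFin (stepProb P₁ (s.delay a) (s.last a)) (stepProb P₂ (s.delay a) (s.last a))
  else if a = h' then
    klFin (stepProb P₂ (s.delay a) (s.last a)) (stepProb P₁ (s.delay a) (s.last a))
  else 0

/-- The constant `R*(P₁, P₂)`, written with odd arm `h`. -/
def Rstar (η : Set.Ioc (0 : ℝ) 1) (P₁ P₂ : S → PMF S) (h : Fin K) : ℝ≥0∞ :=
  ⨆ lam : SRS K S, ⨅ (h' : Fin K) (_ : h' ≠ h),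
    ∑' s, ∑ a, occupancy η P₁ P₂ h lam s a * ENNReal.ofReal (kDiv P₁ P₂ h h' s a)

end Rate

end OddArm

end

open scoped ENNReal Topology

namespace OddArm

noncomputable section

/-! ### Markov kernels on a discrete space with a uniformly accessible state -/

section Ergodic

variable {X : Type*}

/-! The bound combines a change of measure at the stopping time with a comparison of the policy to a
single stationary strategy. Fix a policy in `goodPolicies` with finite expected stopping time, and
an alternative `h' ≠ h`. Index `h` is declared with probability at least `1 - ε` under `h` and at
most `ε` under `h'`, so the log-likelihood ratio accumulated up to stopping has mean at least about
`(1 - ε) log (1/ε) - 1` (`le_obsMean_logRatio`, `exists_log_le_occupation`).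

That mean is a sum of relative entropies between the predictive laws of the pulled arm
(`ofReal_obsMean_logRatio_le`). The first `K` terms are bounded by a constant. Afterwards every arm
has been seen, its predictive law depends only on its delay and last observed state, and each term
is a value of `kDiv`. The sum is thus an integral of `kDiv` against the occupation measure
`policyOcc`, whose mass `T` is at most the expected stopping time.

Conditioning this measure on the state of the delay chain gives a stationary strategy `lam`. The
state marginal is stationary for `lam` up to a defect of mass at most one, coming from its starting
point (`sum_policyOcc_le`). The trembling hand makes one state accessible from everywhere in a fixed
number of steps, with a probability bounded below uniformly in `lam` (`exists_forall_le_kerPow`).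
Hence the Poisson equation has a solution bounded independently of `lam`, and the integral is at
most `T` times its stationary value plus a constant (`tsum_mul_le_stationary`).

The same `lam` serves every `h'`, so dividing by `T` bounds a minimum over `h'`, and therefore
`Rstar`, from below (`exists_log_le_Rstar_mul`). The constants depend on neither `ε` nor the policy.
No compactness of the set of strategies and no attained supremum is needed. -/

open scoped Classical in
/-- The `n`-step transition probabilities of the kernel `A`. -/
def kerPow (A : X → X → ℝ≥0∞) : ℕ → X → X → ℝ≥0∞
  | 0 => fun x y => if y = x then 1 else 0
  | n + 1 => fun x z => ∑' y, kerPow A n x y * A y z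

lemma tsum_kerPow_zero_mul (A : X → X → ℝ≥0∞) (g : X → ℝ≥0∞) (x : X) :
    ∑' y, kerPow A 0 x y * g y = g x := by
  rw [tsum_eq_single x]
  · simp [kerPow]
  · intro y hy
    simp [kerPow, hy]

lemma tsum_kerPow_succ_mul (A : X → X → ℝ≥0∞) (n : ℕ) (g : X → ℝ≥0∞) (x : X) :
    ∑' z, kerPow A (n + 1) x z * g z = ∑' y, kerPow A n x y * ∑' z, A y z * g z := by
  simp only [kerPow, ← ENNReal.tsum_mul_right, ← ENNReal.tsum_mul_left]
  rw [ENNReal.tsum_comm]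
  simp only [mul_assoc]

lemma tsum_kerPow {A : X → X → ℝ≥0∞} (hA : ∀ x, ∑' y, A x y = 1) (n : ℕ) (x : X) :
    ∑' y, kerPow A n x y = 1 := by
  induction n with
  | zero => simpa using tsum_kerPow_zero_mul A (fun _ => 1) x
  | succ n ih => simpa [hA, ih] using tsum_kerPow_succ_mul A n (fun _ => 1) x

lemma kerPow_le_succ (A : X → X → ℝ≥0∞) (n : ℕ) (x y z : X) :
    kerPow A n x y * A y z ≤ kerPow A (n + 1) x z :=
  ENNReal.le_tsum (f := fun y => kerPow A n x y * A y z) y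

lemma tsum_mul_le_of_le {p g : X → ℝ≥0∞} {C G : ℝ≥0∞} (hp : ∑' x, p x ≤ C) (hg : ∀ x, g x ≤ G) :
    ∑' x, p x * g x ≤ C * G :=
  calc ∑' x, p x * g x ≤ ∑' x, p x * G := ENNReal.tsum_le_tsum fun x => mul_le_mul_right (hg x) _
    _ = (∑' x, p x) * G := ENNReal.tsum_mul_right
    _ ≤ C * G := mul_le_mul_left hp _

/-- A measure that is stationary up to a defect of mass at most one. -/
lemma tsum_mul_le_kerPow {A : X → X → ℝ≥0∞} (hA : ∀ x, ∑' y, A x y = 1) {m e : X → ℝ≥0∞}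
    (hm : ∀ y, m y ≤ ∑' x, m x * A x y + e y) (he : ∑' y, e y ≤ 1) {G : ℝ≥0∞} (n : ℕ) :
    ∀ g : X → ℝ≥0∞, (∀ x, g x ≤ G) →
      ∑' x, m x * g x ≤ ∑' x, m x * (∑' y, kerPow A n x y * g y) + n * G := by
  induction n with
  | zero =>
    intro g _
    simp [tsum_kerPow_zero_mul]
  | succ n ih =>
    intro g hg
    -- One application of the kernel costs the integral of `g` against the defect `e`, hence at most
    -- `G`; `n` applications cost `n * G`.
    have h1 : ∑' x, m x * g x ≤ ∑' x, m x * (∑' y, A x y * g y) + G := by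
      calc ∑' y, m y * g y ≤ ∑' y, ((∑' x, m x * A x y) * g y + e y * g y) :=
            ENNReal.tsum_le_tsum fun y => by rw [← add_mul]; exact mul_le_mul_left (hm y) _
        _ = ∑' y, (∑' x, m x * A x y) * g y + ∑' y, e y * g y := ENNReal.tsum_add
        _ ≤ _ := by
          refine add_le_add (le_of_eq ?_) ((tsum_mul_le_of_le he hg).trans (one_mul G).le)
          simp only [← ENNReal.tsum_mul_right, ← ENNReal.tsum_mul_left]
          rw [ENNReal.tsum_comm]
          simp only [mul_assoc]
    have h2 := ih (fun x => ∑' y, A x y * g y) fun x =>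
      (tsum_mul_le_of_le (hA x).le hg).trans (one_mul G).le
    simp only [tsum_kerPow_succ_mul]
    refine h1.trans ((add_le_add_left h2 G).trans (le_of_eq ?_))
    push_cast
    ring

open scoped Classical in
/-- The remainder of a kernel after splitting off mass `δ` at the state `x₀`. -/
def kerRest (B : X → X → ℝ≥0∞) (δ : ℝ≥0∞) (x₀ : X) (x y : X) : ℝ≥0∞ :=
  B x y - if y = x₀ then δ else 0

/-! ### Splitting off a regeneration atom -/

section Split

variable {B : X → X → ℝ≥0∞} (hB : ∀ x, ∑' y, B x y = 1) {δ : ℝ≥0∞} (hδ : δ ≠ 0) {x₀ : X}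
  (hx₀ : ∀ x, δ ≤ B x x₀)

include hx₀ in
open scoped Classical in
lemma kerRest_add (x y : X) : kerRest B δ x₀ x y + (if y = x₀ then δ else 0) = B x y := by
  unfold kerRest
  split_ifs with h
  · rw [h]
    exact tsub_add_cancel_of_le (hx₀ x)
  · simp

include hx₀ in
lemma tsum_eq_kerRest_add (g : X → ℝ≥0∞) (x : X) :
    ∑' y, B x y * g y = ∑' y, kerRest B δ x₀ x y * g y + δ * g x₀ := by
  classical
  simp_rw [← kerRest_add hx₀ x, add_mul]
  rw [ENNReal.tsum_add]
  congr 1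
  rw [tsum_eq_single x₀]
  · simp
  · intro y hy
    simp [hy]

include hB hx₀ in
lemma split_le_one : δ ≤ 1 :=
  (hx₀ x₀).trans ((ENNReal.le_tsum x₀).trans (hB x₀).le)

include hB hx₀ in
lemma tsum_kerRest (x : X) : ∑' y, kerRest B δ x₀ x y = 1 - δ := by
  have h := tsum_eq_kerRest_add hx₀ (fun _ => 1) x
  simp only [mul_one, hB] at h
  exact ENNReal.eq_sub_of_add_eq (ne_top_of_le_ne_top ENNReal.one_ne_top (split_le_one hB hx₀))
    h.symm

include hB hx₀ in
lemma tsum_one_sub_pow : ∑' j : ℕ, (1 - δ) ^ j = δ⁻¹ := by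
  rw [ENNReal.tsum_geometric, ENNReal.sub_sub_cancel ENNReal.one_ne_top (split_le_one hB hx₀)]

include hB hx₀ in
/-- A bounded solution of the Poisson equation. -/
lemma exists_poisson {f : X → ℝ≥0∞} {G : ℝ≥0∞} (hf : ∀ x, f x ≤ G) :
    ∃ (U : X → ℝ≥0∞) (c : ℝ≥0∞), (∀ x, U x ≤ G * δ⁻¹) ∧
      ∀ x, U x + c = f x + ∑' y, B x y * U y := by
  let R := kerRest B δ x₀
  obtain ⟨u, hu0, hus⟩ : ∃ u : ℕ → X → ℝ≥0∞, u 0 = f ∧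
      ∀ j x, u (j + 1) x = ∑' y, R x y * u j y :=
    ⟨fun j => Nat.rec f (fun _ v x => ∑' y, R x y * v y) j, rfl, fun _ _ => rfl⟩
  have hu : ∀ j x, u j x ≤ (1 - δ) ^ j * G := by
    intro j
    induction j with
    | zero => intro x; simpa [hu0] using hf x
    | succ j ih =>
      intro x
      rw [hus]
      refine (tsum_mul_le_of_le (tsum_kerRest hB hx₀ x).le ih).trans (le_of_eq ?_)
      ring
  -- With `R` the remainder, `U = ∑ R ^ j f` satisfies `U = f + R U`, and `B U = R U + δ U(x₀)`; the
  -- shift is therefore `δ U(x₀)`. Keeping it on the left avoids subtraction in `ℝ≥0∞`.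
  refine ⟨fun x => ∑' j, u j x, δ * ∑' j, u j x₀, fun x => ?_, fun x => ?_⟩
  · refine (ENNReal.tsum_le_tsum fun j => hu j x).trans (le_of_eq ?_)
    rw [ENNReal.tsum_mul_right, tsum_one_sub_pow hB hx₀, mul_comm]
  · rw [tsum_eq_kerRest_add hx₀, ← add_assoc]
    congr 1
    beta_reduce
    rw [tsum_eq_zero_add' (f := fun j => u j x) ENNReal.summable, hu0]
    congr 1
    simp only [← ENNReal.tsum_mul_left, hus]
    rw [ENNReal.tsum_comm]

-- Regeneration: started at `x₀`, the chain killed with probability `δ` at each step has expected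
-- lifetime `δ⁻¹`. Its occupation measure, normalised by `δ`, is stationary because the killed mass
-- is returned to `x₀`.
include hB hδ hx₀ in
lemma exists_stationary_of_split :
    ∃ μ : X → ℝ≥0∞, ∑' x, μ x = 1 ∧ ∀ y, ∑' x, μ x * B x y = μ y := by
  classical
  let R := kerRest B δ x₀
  obtain ⟨u, hu0, hus⟩ : ∃ u : ℕ → X → ℝ≥0∞, (∀ x, u 0 x = if x = x₀ then 1 else 0) ∧
      ∀ j y, u (j + 1) y = ∑' x, u j x * R x y :=
    ⟨fun j => Nat.rec (fun x => if x = x₀ then 1 else 0) (fun _ v y => ∑' x, v x * R x y) j,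
      fun _ => rfl, fun _ _ => rfl⟩
  have hu : ∀ j, ∑' x, u j x = (1 - δ) ^ j := by
    intro j
    induction j with
    | zero => simp [hu0]
    | succ j ih =>
      simp only [hus]
      rw [ENNReal.tsum_comm]
      simp only [ENNReal.tsum_mul_left, R, tsum_kerRest hB hx₀, ENNReal.tsum_mul_right, ih]
      ring
  have hmass : ∑' x, ∑' j, u j x = δ⁻¹ := by
    rw [ENNReal.tsum_comm]
    simp only [hu, tsum_one_sub_pow hB hx₀]
  have hδ' : δ * δ⁻¹ = 1 :=
    ENNReal.mul_inv_cancel hδ (ne_top_of_le_ne_top ENNReal.one_ne_top (split_le_one hB hx₀))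
  refine ⟨fun x => δ * ∑' j, u j x, by rw [ENNReal.tsum_mul_left, hmass, hδ'], fun y => ?_⟩
  simp_rw [← kerRest_add hx₀ _ y, mul_add]
  rw [ENNReal.tsum_add]
  simp_rw [mul_assoc, ENNReal.tsum_mul_left, ENNReal.tsum_mul_right]
  rw [hmass]
  rw [tsum_eq_zero_add' (f := fun j => u j y) ENNReal.summable, mul_add, add_comm]
  congr 1
  · rw [← mul_assoc, hδ', hu0]
    split_ifs <;> simp
  · congr 1
    simp only [← ENNReal.tsum_mul_right, hus]
    rw [ENNReal.tsum_comm]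

end Split

variable {A : X → X → ℝ≥0∞} (hA : ∀ x, ∑' y, A x y = 1) {δ : ℝ≥0∞} (hδ : δ ≠ 0) {x₀ : X} {M : ℕ}
  (hx₀ : ∀ x, δ ≤ kerPow A M x x₀)

-- Averaging `μ A ^ k` over `k < M`, for `μ` stationary under `A ^ M`, gives a measure stationary
-- under `A`: applying `A` replaces the term `k = 0` by the equal term `k = M`.
include hA hδ hx₀ in
lemma exists_stationary (hM : M ≠ 0) :
    ∃ μ : X → ℝ≥0∞, ∑' x, μ x = 1 ∧ ∀ y, ∑' x, μ x * A x y = μ y := by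
  obtain ⟨μ, h1, h2⟩ := exists_stationary_of_split (tsum_kerPow hA M) hδ hx₀
  let v : ℕ → X → ℝ≥0∞ := fun k y => ∑' x, μ x * kerPow A k x y
  have hv : ∀ k y, ∑' x, v k x * A x y = v (k + 1) y := by
    intro k y
    simp only [v, kerPow, ← ENNReal.tsum_mul_right, ← ENNReal.tsum_mul_left]
    rw [ENNReal.tsum_comm]
    simp only [mul_assoc]
  have hvm : ∀ k, ∑' x, v k x = 1 := by
    intro k
    simp only [v]
    rw [ENNReal.tsum_comm]
    simp only [ENNReal.tsum_mul_left, tsum_kerPow hA, mul_one, h1]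
  have hv0 : v 0 = v M := by
    funext y
    simp only [v, h2]
    rw [tsum_eq_single y]
    · simp [kerPow]
    · intro x hx
      simp [kerPow, hx.symm]
  refine ⟨fun x => (M : ℝ≥0∞)⁻¹ * ∑ k ∈ Finset.range M, v k x, ?_, fun y => ?_⟩
  · rw [ENNReal.tsum_mul_left, Summable.tsum_finsetSum fun _ _ => ENNReal.summable]
    simp only [hvm, Finset.sum_const, Finset.card_range, nsmul_eq_mul, mul_one]
    exact ENNReal.inv_mul_cancel (by simpa using hM) (ENNReal.natCast_ne_top M)
  · simp only [mul_assoc, ENNReal.tsum_mul_left, Finset.sum_mul]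
    rw [Summable.tsum_finsetSum fun _ _ => ENNReal.summable]
    simp only [hv]
    congr 1
    obtain ⟨n, rfl⟩ := Nat.exists_eq_succ_of_ne_zero hM
    rw [Finset.sum_range_succ, Finset.sum_range_succ' _ n, hv0]

include hA hδ hx₀ in
/-- The integral of a bounded function against an almost stationary measure of mass `T` exceeds `T`
times its stationary mean by at most a constant that does not depend on `T`. -/
lemma tsum_mul_le_stationary {μ m e f : X → ℝ≥0∞} {G : ℝ≥0∞} (hμ1 : ∑' x, μ x = 1)
    (hμ : ∀ y, ∑' x, μ x * A x y = μ y) (hmT : ∑' x, m x ≠ ∞)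
    (hm : ∀ y, m y ≤ ∑' x, m x * A x y + e y) (he : ∑' y, e y ≤ 1) (hG : G ≠ ∞)
    (hf : ∀ x, f x ≤ G) :
    ∑' x, m x * f x ≤ (∑' x, m x) * ∑' x, μ x * f x + M * (G * δ⁻¹) := by
  obtain ⟨U, c, hU, hP⟩ := exists_poisson (tsum_kerPow hA M) hx₀ hf
  have hGδ : G * δ⁻¹ ≠ ∞ := ENNReal.mul_ne_top hG (ENNReal.inv_ne_top.2 hδ)
  have key : ∀ p : X → ℝ≥0∞, ∑' x, p x * U x + (∑' x, p x) * c =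
      ∑' x, p x * f x + ∑' x, p x * ∑' y, kerPow A M x y * U y := by
    intro p
    rw [← ENNReal.tsum_mul_right, ← ENNReal.tsum_add, ← ENNReal.tsum_add]
    exact tsum_congr fun x => by rw [← mul_add, ← mul_add, hP]
  have hstat : ∀ n, ∀ g : X → ℝ≥0∞,
      ∑' x, μ x * ∑' y, kerPow A n x y * g y = ∑' x, μ x * g x := by
    intro n
    induction n with
    | zero => intro g; simp [tsum_kerPow_zero_mul]
    | succ n ih =>
      intro g
      simp only [tsum_kerPow_succ_mul]
      rw [ih]
      have h : ∀ z, μ z * g z = ∑' x, μ x * (A x z * g z) := fun z => by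
        simp only [← mul_assoc, ENNReal.tsum_mul_right, hμ]
      simp only [h, ← ENNReal.tsum_mul_left]
      rw [ENNReal.tsum_comm]
  have hfin : ∀ p : X → ℝ≥0∞, ∑' x, p x ≠ ∞ → ∀ g : X → ℝ≥0∞, (∀ x, g x ≤ G * δ⁻¹) →
      ∑' x, p x * g x ≠ ∞ := fun p hp g hg =>
    ne_top_of_le_ne_top (ENNReal.mul_ne_top hp hGδ) (tsum_mul_le_of_le le_rfl hg)
  -- Integrating the Poisson equation against `μ` cancels both terms in `U` and identifies the
  -- constant as the stationary mean.
  have hc : ∑' x, μ x * f x = c := by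
    have h := key μ
    rw [hμ1, one_mul, hstat, add_comm] at h
    exact ((ENNReal.add_left_inj (hfin μ (by simp [hμ1]) U hU)).1 h).symm
  have hAU : ∀ x, ∑' y, kerPow A M x y * U y ≤ G * δ⁻¹ := fun x =>
    (tsum_mul_le_of_le (tsum_kerPow hA M x).le hU).trans (one_mul _).le
  have h1 := tsum_mul_le_kerPow hA hm he M U hU
  rw [hc]
  -- Integrate the Poisson equation against `m`. Since `m` has finite mass and `U` is bounded, the
  -- term with `A ^ M U` is finite and may be cancelled.
  refine (ENNReal.add_le_add_iff_right (hfin m hmT _ hAU)).1 ?_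
  rw [← key m]
  refine (add_le_add_left h1 _).trans (le_of_eq ?_)
  ring

end Ergodic

/-! ### Finite ergodic chains -/

lemma exists_pos_le_of_ne_zero {ι : Type*} [Finite ι] (f : ι → ℝ≥0∞) :
    ∃ β : ℝ≥0∞, β ≠ 0 ∧ β ≤ 1 ∧ ∀ i, f i ≠ 0 → β ≤ f i := by
  classical
  cases nonempty_fintype ι
  refine ⟨1 ⊓ Finset.univ.inf fun i => if f i = 0 then 1 else f i, ?_, inf_le_left, ?_⟩
  · rw [← pos_iff_ne_zero, lt_inf_iff, Finset.lt_inf_iff ENNReal.zero_lt_top]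
    refine ⟨zero_lt_one, fun i _ => ?_⟩
    split_ifs with h
    · exact zero_lt_one
    · exact pos_iff_ne_zero.2 h
  · intro i hi
    refine inf_le_right.trans ((Finset.inf_le (Finset.mem_univ i)).trans ?_)
    rw [if_neg hi]

lemma sum_pmf_toReal {S : Type*} [Fintype S] (μ : PMF S) : ∑ y, (μ y).toReal = 1 := by
  rw [← ENNReal.toReal_sum fun y _ => μ.apply_ne_top y, ← tsum_fintype (L := .unconditional _),
    μ.tsum_coe, ENNReal.toReal_one]

lemma sum_pmf {S : Type*} [Fintype S] (μ : PMF S) : ∑ y, μ y = 1 := by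
  rw [← tsum_fintype (L := .unconditional _), μ.tsum_coe]

section Chain

variable {S : Type*}

/-- The law after `d` steps of the chain started in a given state. -/
def nStep (P : S → PMF S) : ℕ → S → PMF S
  | 0 => PMF.pure
  | d + 1 => fun i => (nStep P d i).bind P

lemma nStep_one (P : S → PMF S) (i : S) : nStep P 1 i = P i := by
  simp [nStep]

lemma nStep_add (P : S → PMF S) (m n : ℕ) (i : S) :
    nStep P (m + n) i = (nStep P m i).bind (nStep P n) := by
  induction n with
  | zero => simp [nStep]
  | succ n ih =>
    calc nStep P (m + (n + 1)) i = (nStep P (m + n) i).bind P := rfl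
      _ = (nStep P m i).bind (nStep P (n + 1)) := by rw [ih, PMF.bind_bind]; rfl

variable [Fintype S]

lemma nStep_add_apply (P : S → PMF S) (m n : ℕ) (i k : S) :
    nStep P (m + n) i k = ∑ j, nStep P m i j * nStep P n j k := by
  rw [nStep_add, PMF.bind_apply, tsum_fintype]

lemma klFin_le (μ ν : PMF S) {β : ℝ≥0∞} (hβ : β ≠ 0) (h : ∀ y, μ y ≠ 0 → β ≤ ν y) :
    klFin (fun y => (μ y).toReal) (fun y => (ν y).toReal) ≤ -Real.log β.toReal := by
  have key : ∀ y, (μ y).toReal * Real.log ((μ y).toReal / (ν y).toReal) ≤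
      (μ y).toReal * -Real.log β.toReal := by
    intro y
    rcases eq_or_ne (μ y) 0 with h0 | h0
    · simp [h0]
    · have hμ : 0 < (μ y).toReal := ENNReal.toReal_pos h0 (μ.apply_ne_top y)
      have hμ1 : (μ y).toReal ≤ 1 := by
        simpa using ENNReal.toReal_mono ENNReal.one_ne_top (μ.coe_le_one y)
      have hβt : β ≠ ∞ := ne_top_of_le_ne_top (ν.apply_ne_top y) (h y h0)
      have hβ0 : 0 < β.toReal := ENNReal.toReal_pos hβ hβt
      have hν : β.toReal ≤ (ν y).toReal := ENNReal.toReal_mono (ν.apply_ne_top y) (h y h0)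
      refine mul_le_mul_of_nonneg_left ?_ hμ.le
      rw [← Real.log_inv, inv_eq_one_div]
      exact Real.log_le_log (div_pos hμ (hβ0.trans_le hν))
        (div_le_div₀ zero_le_one hμ1 hβ0 hν)
  calc _ ≤ ∑ y, (μ y).toReal * -Real.log β.toReal := Finset.sum_le_sum fun y _ => key y
    _ = _ := by rw [← Finset.sum_mul, sum_pmf_toReal, one_mul]

variable [DecidableEq S]

lemma nStep_toReal (P : S → PMF S) (d : ℕ) (i j : S) :
    (nStep P d i j).toReal = stepProb P d i j := by
  induction d generalizing j with
  | zero =>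
    rw [stepProb, pow_zero, Matrix.one_apply, nStep, PMF.pure_apply]
    by_cases h : i = j
    · simp [h]
    · simp [h, Ne.symm h]
  | succ d ih =>
    rw [nStep, PMF.bind_apply, tsum_fintype, ENNReal.toReal_sum fun y _ =>
      ENNReal.mul_ne_top (PMF.apply_ne_top _ y) (PMF.apply_ne_top _ j), stepProb, pow_succ,
      Matrix.mul_apply]
    refine Finset.sum_congr rfl fun y _ => ?_
    rw [ENNReal.toReal_mul, ih]
    rfl

lemma ofReal_stepProb (P : S → PMF S) (d : ℕ) (i j : S) :
    ENNReal.ofReal (stepProb P d i j) = nStep P d i j := by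
  rw [← nStep_toReal, ENNReal.ofReal_toReal (PMF.apply_ne_top _ j)]

lemma stepProb_nonneg (P : S → PMF S) (d : ℕ) (i j : S) : 0 ≤ stepProb P d i j := by
  rw [← nStep_toReal]
  exact ENNReal.toReal_nonneg

lemma stepProb_pos_iff (P : S → PMF S) (d : ℕ) (i j : S) :
    0 < stepProb P d i j ↔ nStep P d i j ≠ 0 := by
  rw [← ofReal_stepProb, ← pos_iff_ne_zero, ENNReal.ofReal_pos]

lemma stepProb_add_pos {P : S → PMF S} {m n : ℕ} {i j k : S} (h₁ : 0 < stepProb P m i j)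
    (h₂ : 0 < stepProb P n j k) : 0 < stepProb P (m + n) i k := by
  rw [stepProb, pow_add, Matrix.mul_apply]
  exact Finset.sum_pos' (fun l _ => mul_nonneg (stepProb_nonneg P m i l) (stepProb_nonneg P n l k))
    ⟨j, Finset.mem_univ j, mul_pos h₁ h₂⟩

/-- The return times to a state form an additive semigroup with greatest common divisor one, so they
contain all large integers. Irreducibility then extends this from returns to arbitrary pairs of
states. -/
lemma IsErgodicChain.exists_forall_ge_pos {P : S → PMF S} (hP : IsErgodicChain P) :
    ∃ N, ∀ n ≥ N, ∀ i j, nStep P n i j ≠ 0 := by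
  have hret : ∀ i, ∃ N, ∀ n ≥ N, 0 < stepProb P n i i := by
    intro i
    let s : Set ℕ := {n | 1 ≤ n ∧ 0 < stepProb P n i i}
    have hg : Nat.setGcd s = 1 := hP.2 i _ fun n h1 h2 => Nat.setGcd_dvd_of_mem ⟨h1, h2⟩
    obtain ⟨N, hN⟩ := Nat.exists_mem_closure_of_ge s
    refine ⟨N, fun n hn => ?_⟩
    have hmem := hN n hn (by rw [hg]; exact one_dvd n)
    refine AddSubmonoid.closure_induction (motive := fun n _ => 0 < stepProb P n i i)
      (fun n hn => hn.2) ?_ (fun _ _ _ _ h1 h2 => stepProb_add_pos h1 h2) hmem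
    simp [stepProb]
  choose N hN using hret
  have hirr := (Matrix.isIrreducible_iff_exists_pow_pos hP.1.nonneg).1 hP.1
  choose k _ hk using hirr
  refine ⟨Finset.univ.sup fun i => Finset.univ.sup fun j => N i + k i j, fun n hn i j => ?_⟩
  have hle : N i + k i j ≤ n := le_trans
    (le_trans (Finset.le_sup (f := fun j => N i + k i j) (Finset.mem_univ j))
      (Finset.le_sup (f := fun i => Finset.univ.sup fun j => N i + k i j) (Finset.mem_univ i))) hn
  rw [← stepProb_pos_iff, show n = (n - k i j) + k i j by omega]
  exact stepProb_add_pos (hN i _ (by omega)) (hk i j)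

/-- Only finitely many `d` matter: for large `d` the last `N` steps alone have probability at least
the minimum of the strictly positive matrix `P ^ N`, wherever the chain stands before them.
Uniformity in `d` is needed because delays are unbounded. -/
lemma IsErgodicChain.exists_le_nStep {P : S → PMF S} (hP : IsErgodicChain P) :
    ∃ β : ℝ≥0∞, β ≠ 0 ∧ β ≤ 1 ∧ ∀ d i j, nStep P d i j ≠ 0 → β ≤ nStep P d i j := by
  obtain ⟨N, hN⟩ := hP.exists_forall_ge_pos
  obtain ⟨β₁, h0, h1, h⟩ :=
    exists_pos_le_of_ne_zero fun x : Fin (N + 1) × S × S => nStep P x.1 x.2.1 x.2.2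
  refine ⟨β₁, h0, h1, fun d i j hd => ?_⟩
  rcases lt_or_ge d (N + 1) with hlt | hge
  · exact h (⟨d, hlt⟩, i, j) hd
  · rw [show d = (d - N) + N by omega, nStep_add_apply]
    calc β₁ = ∑ k, nStep P (d - N) i k * β₁ := by rw [← Finset.sum_mul, sum_pmf, one_mul]
      _ ≤ _ := Finset.sum_le_sum fun k _ =>
        mul_le_mul_right (h (⟨N, N.lt_succ_self⟩, k, j) (hN N le_rfl k j)) _

end Chain

/-! ### The chain of delays and last observed states -/

section DelayChain

variable {K : ℕ} {S : Type*}

lemma DState.eq_of {s t : DState K S} (h₁ : ∀ c, s.delay c = t.delay c)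
    (h₂ : ∀ c, s.last c = t.last c) : s = t := by
  cases s
  cases t
  simp only [DState.mk.injEq]
  exact ⟨funext h₁, funext h₂⟩

/-- The state after arm `a` is pulled and found in the state `x`. -/
def DState.pull (s : DState K S) (a : Fin K) (x : S) : DState K S where
  delay c := if c = a then 1 else s.delay c + 1
  last c := if c = a then x else s.last c
  one_le_delay c := by split_ifs <;> omega
  existsUnique_delay_eq_one := ⟨a, by simp, fun c hc => by
    by_contra hca
    have := s.one_le_delay c
    simp only [hca, if_false] at hc
    omega⟩

lemma DState.exists_state [Nonempty S] (hK : 0 < K) : Nonempty (DState K S) := by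
  obtain ⟨x⟩ := ‹Nonempty S›
  refine ⟨⟨fun c => c + 1, fun _ => x, fun c => by omega, ⟨0, hK⟩, by simp, fun c hc => ?_⟩⟩
  ext
  simpa using hc

variable [Fintype S] [DecidableEq S]

open scoped Classical in
lemma pullTrans_eq_sum (P₁ P₂ : S → PMF S) (h : Fin K) (s : DState K S) (a : Fin K)
    (s' : DState K S) : pullTrans P₁ P₂ h s a s' =
      ∑ x, nStep (armLaw P₁ P₂ h a) (s.delay a) (s.last a) x * if s.pull a x = s' then 1 else 0 := by
  unfold pullTrans
  split_ifs with hs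
  · have : ∀ x, s.pull a x = s' ↔ x = s'.last a := by
      refine fun x => ⟨fun hx => by simp [← hx, DState.pull], fun hx => ?_⟩
      refine DState.eq_of (fun c => ?_) fun c => ?_ <;> by_cases hc : c = a
      · subst hc; simp [DState.pull, hs.1]
      · simp [DState.pull, hc, (hs.2 c hc).1]
      · subst hc; simp [DState.pull, hx]
      · simp [DState.pull, hc, (hs.2 c hc).2]
    simp [this, ofReal_stepProb]
  · refine (Finset.sum_eq_zero fun x _ => ?_).symm
    rw [if_neg, mul_zero]
    rintro rfl
    exact hs ⟨by simp [DState.pull], fun c hc => by simp [DState.pull, hc]⟩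

lemma tsum_pullTrans_mul (P₁ P₂ : S → PMF S) (h : Fin K) (s : DState K S) (a : Fin K)
    (g : DState K S → ℝ≥0∞) : ∑' s', pullTrans P₁ P₂ h s a s' * g s' =
      ∑ x, nStep (armLaw P₁ P₂ h a) (s.delay a) (s.last a) x * g (s.pull a x) := by
  classical
  simp only [pullTrans_eq_sum, Finset.sum_mul]
  rw [Summable.tsum_finsetSum fun _ _ => ENNReal.summable]
  refine Finset.sum_congr rfl fun x _ => ?_
  rw [tsum_eq_single (s.pull a x)]
  · simp
  · intro s' hs'
    simp [hs'.symm]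

/-- The transition probabilities of the chain of delays and last observed states. -/
def delayKer (η : Set.Ioc (0 : ℝ) 1) (P₁ P₂ : S → PMF S) (h : Fin K) (lam : SRS K S)
    (s s' : DState K S) : ℝ≥0∞ :=
  ∑ a, pullProb η lam s a * pullTrans P₁ P₂ h s a s'

omit [Fintype S] [DecidableEq S] in
lemma sum_pullProb (η : Set.Ioc (0 : ℝ) 1) (hK : 0 < K) (lam : SRS K S) (s : DState K S) :
    ∑ a, pullProb η lam s a = 1 := by
  have h0 := η.2.1.le
  have h1 : (0 : ℝ) ≤ 1 - η := sub_nonneg.2 η.2.2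
  have hK' : (0 : ℝ) < K := by exact_mod_cast hK
  simp only [pullProb, Finset.sum_add_distrib, ← Finset.mul_sum, sum_pmf, mul_one]
  rw [Finset.sum_const, Finset.card_univ, Fintype.card_fin, nsmul_eq_mul,
    ← ENNReal.ofReal_natCast, ← ENNReal.ofReal_mul hK'.le, mul_div_cancel₀ _ hK'.ne',
    ← ENNReal.ofReal_add h0 h1]
  simp

lemma tsum_delayKer (η : Set.Ioc (0 : ℝ) 1) (P₁ P₂ : S → PMF S) (h : Fin K) (hK : 0 < K)
    (lam : SRS K S) (s : DState K S) : ∑' s', delayKer η P₁ P₂ h lam s s' = 1 := by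
  unfold delayKer
  rw [Summable.tsum_finsetSum fun _ _ => ENNReal.summable]
  have : ∀ a, ∑' s', pullTrans P₁ P₂ h s a s' = 1 := fun a => by
    simpa [sum_pmf] using tsum_pullTrans_mul P₁ P₂ h s a fun _ => 1
  simp only [ENNReal.tsum_mul_left, this, mul_one, sum_pullProb η hK]

/-- The trembling hand pulls every arm with probability at least `η / K`, so the bound does not
involve `lam`. -/
lemma le_delayKer_pull (η : Set.Ioc (0 : ℝ) 1) {P₁ P₂ : S → PMF S} {h : Fin K} (lam : SRS K S)
    {β : ℝ≥0∞} (hβ : ∀ c d i j, nStep (armLaw P₁ P₂ h c) d i j ≠ 0 →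
      β ≤ nStep (armLaw P₁ P₂ h c) d i j) (s : DState K S) (a : Fin K) (x : S)
    (hx : nStep (armLaw P₁ P₂ h a) (s.delay a) (s.last a) x ≠ 0) :
    ENNReal.ofReal ((η : ℝ) / K) * β ≤ delayKer η P₁ P₂ h lam s (s.pull a x) := by
  classical
  calc ENNReal.ofReal ((η : ℝ) / K) * β
      ≤ pullProb η lam s a * pullTrans P₁ P₂ h s a (s.pull a x) := by
        refine mul_le_mul' le_self_add ?_
        rw [pullTrans_eq_sum]
        refine le_trans ?_ (Finset.single_le_sum (fun _ _ => zero_le) (Finset.mem_univ x))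
        simpa using hβ a _ _ _ hx
    _ ≤ _ := Finset.single_le_sum (f := fun b => pullProb η lam s b *
        pullTrans P₁ P₂ h s b (s.pull a x)) (fun _ _ => zero_le) (Finset.mem_univ a)

/-! ### A delay state reached uniformly from every state -/

section Reach

variable {η : Set.Ioc (0 : ℝ) 1} {P₁ P₂ : S → PMF S} {h : Fin K} {lam : SRS K S} {β : ℝ≥0∞}
  (hβ : ∀ c d i j, nStep (armLaw P₁ P₂ h c) d i j ≠ 0 → β ≤ nStep (armLaw P₁ P₂ h c) d i j)

include hβ in
/-- Pulling one arm `n + 1` times in a row. -/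
lemma exists_le_kerPow_repeat (a : Fin K) (s : DState K S) (n : ℕ) : ∀ z : S,
    nStep (armLaw P₁ P₂ h a) (s.delay a + n) (s.last a) z ≠ 0 →
    ∃ s', (ENNReal.ofReal ((η : ℝ) / K) * β) ^ (n + 1) ≤
      kerPow (delayKer η P₁ P₂ h lam) (n + 1) s s' ∧ s'.delay a = 1 ∧ s'.last a = z ∧
      ∀ c ≠ a, s'.delay c = s.delay c + (n + 1) := by
  induction n with
  | zero =>
    intro z hz
    refine ⟨s.pull a z, ?_, by simp [DState.pull], by simp [DState.pull],
      fun c hc => by simp [DState.pull, hc]⟩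
    refine le_trans ?_ (kerPow_le_succ _ 0 s s _)
    simpa [kerPow] using le_delayKer_pull η lam hβ s a z hz
  | succ n ih =>
    intro z hz
    rw [← add_assoc, nStep_add_apply] at hz
    -- Only the first pull uses the initial delay; each later one has delay one. The path is cut at
    -- its penultimate state `j`.
    obtain ⟨j, _, hj⟩ := Finset.exists_ne_zero_of_sum_ne_zero hz
    obtain ⟨s', h1, h2, h3, h4⟩ := ih j (left_ne_zero_of_mul hj)
    refine ⟨s'.pull a z, ?_, by simp [DState.pull], by simp [DState.pull],
      fun c hc => by simp [DState.pull, hc, h4, add_assoc]⟩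
    refine le_trans ?_ (kerPow_le_succ _ (n + 1) s s' _)
    rw [pow_succ]
    refine mul_le_mul' h1 (le_delayKer_pull η lam hβ s' a z ?_)
    rw [h2, h3]
    exact right_ne_zero_of_mul hj

variable {N : ℕ} (hN : ∀ c, ∀ n ≥ N, ∀ i j, nStep (armLaw P₁ P₂ h c) n i j ≠ 0)

include hβ hN in
/-- Pulling the first arm many times in a row and then the next `k` arms in order. -/
lemma exists_le_kerPow_sweep (i₀ : S) (s : DState K S) (k : ℕ) : k < K →
    ∃ s', (ENNReal.ofReal ((η : ℝ) / K) * β) ^ (N + 1 + k) ≤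
      kerPow (delayKer η P₁ P₂ h lam) (N + 1 + k) s s' ∧
      ∀ c : Fin K, (c.val ≤ k → s'.last c = i₀ ∧ s'.delay c = k - c.val + 1) ∧
        (k < c.val → N ≤ s'.delay c) := by
  induction k with
  | zero =>
    intro hK
    obtain ⟨s', h1, h2, h3, h4⟩ := exists_le_kerPow_repeat (η := η) (lam := lam) hβ ⟨0, hK⟩ s N i₀
      (hN _ _ (by omega) _ _)
    refine ⟨s', h1, fun c => ⟨fun hc => ?_, fun hc => ?_⟩⟩
    · obtain rfl : c = ⟨0, hK⟩ := Fin.ext (by simpa using hc)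
      exact ⟨h3, by simpa using h2⟩
    · rw [h4 c (by rintro rfl; simp at hc)]
      omega
  | succ k ih =>
    intro hk
    obtain ⟨s', h1, h2⟩ := ih (by omega)
    refine ⟨s'.pull ⟨k + 1, hk⟩ i₀, ?_, fun c => ?_⟩
    · refine le_trans ?_ (kerPow_le_succ _ (N + 1 + k) s s' _)
      rw [← add_assoc, pow_succ]
      refine mul_le_mul' h1 (le_delayKer_pull η lam hβ s' _ _ (hN _ _ ?_ _ _))
      exact (h2 ⟨k + 1, hk⟩).2 (by simp)
    · by_cases hc : c = ⟨k + 1, hk⟩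
      · subst hc
        simp [DState.pull]
      · have hc' : c.val ≠ k + 1 := fun hc' => hc (Fin.ext hc')
        simp only [DState.pull, hc, if_false]
        refine ⟨fun hle => ?_, fun hlt => ?_⟩
        · obtain ⟨h3, h4⟩ := (h2 c).1 (by omega)
          exact ⟨h3, by omega⟩
        · have := (h2 c).2 (by omega)
          omega

-- The repeated pulls of the first arm raise all other delays to at least `N`, so each later arm can
-- be found in `i₀` whatever was seen before. After one sweep the delays are fixed by the order of
-- the pulls, and the final state no longer depends on the start.
include hβ hN in
lemma exists_forall_le_kerPow [Nonempty S] (hK : 0 < K) :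
    ∃ x₀, ∀ s, (ENNReal.ofReal ((η : ℝ) / K) * β) ^ (N + K) ≤
      kerPow (delayKer η P₁ P₂ h lam) (N + K) s x₀ := by
  obtain ⟨i₀⟩ := ‹Nonempty S›
  obtain ⟨t⟩ := DState.exists_state (S := S) hK
  have key := fun s => exists_le_kerPow_sweep (η := η) (lam := lam) hβ hN i₀ s (K - 1) (by omega)
  rw [show N + 1 + (K - 1) = N + K by omega] at key
  obtain ⟨x₀, -, h0⟩ := key t
  refine ⟨x₀, fun s => ?_⟩
  obtain ⟨s', h1, h2⟩ := key s
  obtain rfl : s' = x₀ := by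
    refine DState.eq_of (fun c => ?_) fun c => ?_
    · rw [((h2 c).1 (by omega)).2, ((h0 c).1 (by omega)).2]
    · rw [((h2 c).1 (by omega)).1, ((h0 c).1 (by omega)).1]
  exact h1

end Reach

lemma IsErgodicChain.exists_armLaw_bounds {P₁ P₂ : S → PMF S} (hP₁ : IsErgodicChain P₁)
    (hP₂ : IsErgodicChain P₂) :
    ∃ (N : ℕ) (β : ℝ≥0∞), β ≠ 0 ∧ β ≤ 1 ∧ ∀ h c : Fin K,
      (∀ n ≥ N, ∀ i j, nStep (armLaw P₁ P₂ h c) n i j ≠ 0) ∧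
      ∀ d i j, nStep (armLaw P₁ P₂ h c) d i j ≠ 0 → β ≤ nStep (armLaw P₁ P₂ h c) d i j := by
  obtain ⟨N₁, hN₁⟩ := hP₁.exists_forall_ge_pos
  obtain ⟨N₂, hN₂⟩ := hP₂.exists_forall_ge_pos
  obtain ⟨β₁, h1, h1', hβ₁⟩ := hP₁.exists_le_nStep
  obtain ⟨β₂, h2, -, hβ₂⟩ := hP₂.exists_le_nStep
  refine ⟨max N₁ N₂, min β₁ β₂, ?_, (min_le_left _ _).trans h1', fun h c => ?_⟩
  · rw [← pos_iff_ne_zero, lt_min_iff]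
    exact ⟨pos_iff_ne_zero.2 h1, pos_iff_ne_zero.2 h2⟩
  · unfold armLaw
    split_ifs
    · exact ⟨fun n hn => hN₁ n (le_of_max_le_left hn),
        fun d i j hd => (min_le_left _ _).trans (hβ₁ d i j hd)⟩
    · exact ⟨fun n hn => hN₂ n (le_of_max_le_right hn),
        fun d i j hd => (min_le_right _ _).trans (hβ₂ d i j hd)⟩

/-- Existence rules out the default value `0`. Uniqueness is not needed: `tsum_mul_le_stationary`
holds for whichever stationary distribution was chosen. -/
lemma isStationary_stationaryDist (η : Set.Ioc (0 : ℝ) 1) {P₁ P₂ : S → PMF S}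
    (hP₁ : IsErgodicChain P₁) (hP₂ : IsErgodicChain P₂) [Nonempty S] (h : Fin K) (lam : SRS K S) :
    ∑' s, stationaryDist η P₁ P₂ h lam s = 1 ∧
      ∀ s', ∑' s, stationaryDist η P₁ P₂ h lam s * delayKer η P₁ P₂ h lam s s' =
        stationaryDist η P₁ P₂ h lam s' := by
  have hiff : ∀ μ : PMF (DState K S), IsStationary η P₁ P₂ h lam μ ↔
      ∀ s', ∑' s, μ s * delayKer η P₁ P₂ h lam s s' = μ s' := fun μ => by
    simp only [IsStationary, delayKer, Finset.mul_sum, mul_assoc]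
  have hex : ∃ μ : PMF (DState K S), IsStationary η P₁ P₂ h lam μ := by
    obtain ⟨N, β, hβ0, -, hb⟩ := IsErgodicChain.exists_armLaw_bounds (K := K) hP₁ hP₂
    obtain ⟨x₀, hx₀⟩ := exists_forall_le_kerPow (η := η) (lam := lam) (fun c => (hb h c).2)
      (fun c => (hb h c).1) h.pos
    have hη : ENNReal.ofReal ((η : ℝ) / K) ≠ 0 := by
      have hη := η.2.1
      have hK : (0 : ℝ) < K := by exact_mod_cast h.pos
      simpa using by positivity
    obtain ⟨μ, h1, h2⟩ := exists_stationary (tsum_delayKer η P₁ P₂ h h.pos lam)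
      (pow_ne_zero _ (mul_ne_zero hη hβ0)) hx₀ (by have := h.pos; omega)
    exact ⟨⟨μ, h1 ▸ ENNReal.summable.hasSum⟩, (hiff _).2 h2⟩
  unfold stationaryDist
  rw [dif_pos hex]
  exact ⟨hex.choose.tsum_coe, (hiff _).1 hex.choose_spec⟩

end DelayChain

/-! ### The law of the observations -/

section ObservationLaw

variable {K : ℕ} {S : Type*} [Fintype S]

/-- A family of laws for the current states of the arms, given the observations so far. -/
abbrev Belief (K : ℕ) (S : Type*) := (n : ℕ) → (Fin n → Obs K S) → Fin K → PMF S

/-- The probability of a sequence of observations when the state of the pulled arm is drawn from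
the belief. -/
def obsWeight (η : Set.Ioc (0 : ℝ) 1) (π : Policy K S) (bel : Belief K S) :
    (n : ℕ) → (Fin n → Obs K S) → ℝ≥0∞
  | 0, _ => 1
  | n + 1, o => obsWeight η π bel n (Fin.init o) *
      (controlLaw η π n (Fin.init o) ((o (Fin.last n)).1, (o (Fin.last n)).2.1) *
        bel n (Fin.init o) (o (Fin.last n)).2.1 (o (Fin.last n)).2.2)

omit [Fintype S] in
lemma obsWeight_snoc (η : Set.Ioc (0 : ℝ) 1) (π : Policy K S) (bel : Belief K S) (n : ℕ)
    (o : Fin n → Obs K S) (b a : Fin K) (x : S) :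
    obsWeight η π bel (n + 1) (Fin.snoc o (b, a, x)) =
      obsWeight η π bel n o * (controlLaw η π n o (b, a) * bel n o a x) := by
  simp only [obsWeight, Fin.init_snoc, Fin.snoc_last]

omit [Fintype S] in
lemma obsWeight_ne_top (η : Set.Ioc (0 : ℝ) 1) (π : Policy K S) (bel : Belief K S) (n : ℕ)
    (o : Fin n → Obs K S) : obsWeight η π bel n o ≠ ∞ := by
  induction n with
  | zero => simp [obsWeight]
  | succ n ih =>
    rw [obsWeight]
    exact ENNReal.mul_ne_top (ih _) (ENNReal.mul_ne_top (PMF.apply_ne_top _ _) (PMF.apply_ne_top _ _))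

/-- The expectation of a function of the first `n` observations. -/
def obsExp (η : Set.Ioc (0 : ℝ) 1) (π : Policy K S) (bel : Belief K S) (n : ℕ)
    (F : (Fin n → Obs K S) → ℝ≥0∞) : ℝ≥0∞ :=
  ∑ o, obsWeight η π bel n o * F o

omit [Fintype S] in
lemma sum_snoc {M : Type*} [AddCommMonoid M] [Fintype S] (n : ℕ)
    (F : (Fin (n + 1) → Obs K S) → M) :
    ∑ o, F o = ∑ o : Fin n → Obs K S, ∑ b, ∑ a, ∑ x, F (Fin.snoc o (b, a, x)) := by
  rw [← (Fin.snocEquiv fun _ : Fin (n + 1) => Obs K S).sum_comp, Fintype.sum_prod_type_right]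
  simp only [Fintype.sum_prod_type]
  rfl

lemma obsExp_succ (η : Set.Ioc (0 : ℝ) 1) (π : Policy K S) (bel : Belief K S) (n : ℕ)
    (F : (Fin (n + 1) → Obs K S) → ℝ≥0∞) :
    obsExp η π bel (n + 1) F = obsExp η π bel n fun o =>
      ∑ b, ∑ a, ∑ x, controlLaw η π n o (b, a) * bel n o a x * F (Fin.snoc o (b, a, x)) := by
  simp only [obsExp]
  rw [sum_snoc]
  simp only [obsWeight_snoc, Finset.mul_sum, mul_assoc]

lemma sum_controlLaw_mul (η : Set.Ioc (0 : ℝ) 1) (π : Policy K S) (bel : Belief K S) (n : ℕ)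
    (o : Fin n → Obs K S) :
    ∑ b, ∑ a, ∑ x, controlLaw η π n o (b, a) * bel n o a x = 1 := by
  simp only [← Finset.mul_sum, sum_pmf, mul_one]
  rw [← Fintype.sum_prod_type' fun b a => controlLaw η π n o (b, a)]
  exact sum_pmf _

lemma obsExp_init (η : Set.Ioc (0 : ℝ) 1) (π : Policy K S) (bel : Belief K S) (n : ℕ)
    (F : (Fin n → Obs K S) → ℝ≥0∞) :
    obsExp η π bel (n + 1) (fun o => F (Fin.init o)) = obsExp η π bel n F := by
  rw [obsExp_succ]
  simp only [Fin.init_snoc, ← Finset.sum_mul, sum_controlLaw_mul, one_mul]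

lemma obsExp_one (η : Set.Ioc (0 : ℝ) 1) (π : Policy K S) (bel : Belief K S) (n : ℕ) :
    obsExp η π bel n (fun _ => 1) = 1 := by
  induction n with
  | zero => simp [obsExp, obsWeight]
  | succ n ih => rw [obsExp_init η π bel n fun _ => 1, ih]

lemma obsExp_add (η : Set.Ioc (0 : ℝ) 1) (π : Policy K S) (bel : Belief K S) (n : ℕ)
    (F G : (Fin n → Obs K S) → ℝ≥0∞) :
    obsExp η π bel n (fun o => F o + G o) = obsExp η π bel n F + obsExp η π bel n G := by
  simp only [obsExp, mul_add, Finset.sum_add_distrib]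

lemma obsExp_mono (η : Set.Ioc (0 : ℝ) 1) (π : Policy K S) (bel : Belief K S) (n : ℕ)
    {F G : (Fin n → Obs K S) → ℝ≥0∞} (h : ∀ o, obsWeight η π bel n o ≠ 0 → F o ≤ G o) :
    obsExp η π bel n F ≤ obsExp η π bel n G := by
  refine Finset.sum_le_sum fun o _ => ?_
  rcases eq_or_ne (obsWeight η π bel n o) 0 with h0 | h0
  · simp [h0]
  · exact mul_le_mul_right (h o h0) _

lemma obsExp_le_one (η : Set.Ioc (0 : ℝ) 1) (π : Policy K S) (bel : Belief K S) (n : ℕ)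
    {F : (Fin n → Obs K S) → ℝ≥0∞} (h : ∀ o, F o ≤ 1) : obsExp η π bel n F ≤ 1 :=
  (obsExp_mono η π bel n fun o _ => h o).trans (obsExp_one η π bel n).le

lemma one_le_obsExp (η : Set.Ioc (0 : ℝ) 1) (π : Policy K S) (bel : Belief K S) (n : ℕ)
    {F : (Fin n → Obs K S) → ℝ≥0∞} (h : ∀ o, 1 ≤ F o) : 1 ≤ obsExp η π bel n F :=
  (obsExp_one η π bel n).ge.trans (obsExp_mono η π bel n fun o _ => h o)

/-- The law of the current states of the arms given the observations so far, when `h` is the odd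
arm. -/
def belief (P₁ P₂ : S → PMF S) (ρ : Fin K → PMF S) (h : Fin K) : Belief K S
  | 0, _ => ρ
  | n + 1, o => fun c =>
      if c = (o (Fin.last n)).2.1 then armLaw P₁ P₂ h c (o (Fin.last n)).2.2
      else (belief P₁ P₂ ρ h n (Fin.init o) c).bind (armLaw P₁ P₂ h c)

omit [Fintype S] in
lemma belief_snoc (P₁ P₂ : S → PMF S) (ρ : Fin K → PMF S) (h : Fin K) (n : ℕ)
    (o : Fin n → Obs K S) (b a : Fin K) (x : S) :
    belief P₁ P₂ ρ h (n + 1) (Fin.snoc o (b, a, x)) = fun c =>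
      if c = a then armLaw P₁ P₂ h c x
      else (belief P₁ P₂ ρ h n o c).bind (armLaw P₁ P₂ h c) := by
  simp only [belief, Fin.init_snoc, Fin.snoc_last]

lemma tsum_bind_mul {α β : Type*} (p : PMF α) (f : α → PMF β) (g : β → ℝ≥0∞) :
    ∑' y, p.bind f y * g y = ∑' x, p x * ∑' y, f x y * g y := by
  simp only [PMF.bind_apply, ← ENNReal.tsum_mul_right, ← ENNReal.tsum_mul_left]
  rw [ENNReal.tsum_comm]
  simp only [mul_assoc]

lemma tsum_map_mul {α β : Type*} (p : PMF α) (f : α → β) (g : β → ℝ≥0∞) :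
    ∑' y, p.map f y * g y = ∑' x, p x * g (f x) := by
  classical
  rw [PMF.map, tsum_bind_mul]
  refine tsum_congr fun x => ?_
  rw [tsum_eq_single (f x)]
  · simp
  · intro y hy
    simp [hy]

lemma tsum_recLaw_mul (η : Set.Ioc (0 : ℝ) 1) (π : Policy K S) (t : ℕ) (o : Fin t → Obs K S)
    (p : Fin K → PMF S) (g : Rec K S → ℝ≥0∞) :
    ∑' r, recLaw η π t o p r * g r =
      ∑ x, productLaw p x * ∑ b, ∑ a, controlLaw η π t o (b, a) * g ⟨x, b, a⟩ := by
  rw [recLaw, tsum_bind_mul, tsum_fintype]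
  refine Finset.sum_congr rfl fun x _ => ?_
  rw [tsum_map_mul, tsum_fintype, Fintype.sum_prod_type]

lemma productLaw_apply (p : Fin K → PMF S) (x : Fin K → S) : productLaw p x = ∏ c, p c (x c) := rfl

lemma sum_mul_sum_sum {α β γ : Type*} [Fintype α] [Fintype β] [Fintype γ] (p : α → ℝ≥0∞)
    (f : α → β → γ → ℝ≥0∞) :
    ∑ x, p x * ∑ b, ∑ a, f x b a = ∑ b, ∑ a, ∑ x, p x * f x b a := by
  simp only [Finset.mul_sum]
  rw [Finset.sum_comm]
  exact Finset.sum_congr rfl fun b _ => Finset.sum_comm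

/-- Independent arms, one of which is observed, make a step. -/
lemma sum_productLaw_step (p : Fin K → PMF S) (Q : Fin K → S → PMF S) (a : Fin K)
    (G : S → (Fin K → S) → ℝ≥0∞) :
    ∑ x, productLaw p x * ∑ y, productLaw (fun c => Q c (x c)) y * G (x a) y =
      ∑ z, p a z * ∑ y, productLaw (fun c => if c = a then Q c z else (p c).bind (Q c)) y *
        G z y := by
  classical
  simp only [Finset.mul_sum]
  rw [Finset.sum_comm]
  conv_rhs => rw [Finset.sum_comm]
  refine Finset.sum_congr rfl fun y _ => ?_
  -- The indicator of `x a = z` pins the observed coordinate; the summand becomes a product over the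
  -- arms, and the sum over `x` factorises.
  have h1 : ∀ x : Fin K → S,
      productLaw p x * (productLaw (fun c => Q c (x c)) y * G (x a) y) =
        ∑ z, G z y * ∏ c, (p c (x c) * Q c (x c) (y c) *
          if c = a then (if x c = z then 1 else 0) else 1) := by
    intro x
    simp only [Finset.prod_mul_distrib, Finset.prod_ite_eq', Finset.mem_univ, if_true,
      productLaw_apply]
    rw [Finset.sum_eq_single (x a)]
    · simp only [if_true]
      ring
    · intro z _ hz
      simp [hz.symm]
    · simp
  simp only [h1]
  rw [Finset.sum_comm]
  refine Finset.sum_congr rfl fun z _ => ?_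
  have h2 : ∀ c, ∑ j, (p c j * Q c j (y c) * if c = a then (if j = z then 1 else 0) else 1) =
      (if c = a then p c z else 1) * (if c = a then Q c z else (p c).bind (Q c)) (y c) := by
    intro c
    split_ifs with hc
    · simp
    · simp [PMF.bind_apply, tsum_fintype]
  rw [← Finset.mul_sum]
  have h3 := Finset.prod_univ_sum (fun _ : Fin K => (Finset.univ : Finset S)) fun c j =>
    (p c j * Q c j (y c) * if c = a then (if j = z then 1 else 0) else 1)
  rw [Fintype.piFinset_univ] at h3
  rw [← h3]
  simp only [h2, Finset.prod_mul_distrib, Finset.prod_ite_eq', Finset.mem_univ, if_true,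
    productLaw_apply]
  ring

/-- The first `n` observations. -/
def obsUpTo (n : ℕ) (ω : ℕ → Rec K S) : Fin n → Obs K S := fun t => (ω t).obs

omit [Fintype S] in
lemma obsUpTo_succ (n : ℕ) (ω : ℕ → Rec K S) :
    obsUpTo (n + 1) ω = Fin.snoc (obsUpTo n ω) (ω n).obs :=
  (Fin.snoc_init_self _).symm

lemma lintegral_pmf {α : Type*} [MeasurableSpace α] [DiscreteMeasurableSpace α] [Countable α]
    (p : PMF α) (f : α → ℝ≥0∞) : ∫⁻ x, f x ∂p.toMeasure = ∑' x, p x * f x := by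
  rw [MeasureTheory.lintegral_countable']
  exact tsum_congr fun x => by
    rw [PMF.toMeasure_apply_singleton _ _ (MeasurableSet.of_discrete), mul_comm]

/-! ### From the trajectory measure to finite sums over observations -/

section Trajectory

variable (η : Set.Ioc (0 : ℝ) 1) (P₁ P₂ : S → PMF S) (ρ : Fin K → PMF S) (h : Fin K)
  (π : Policy K S)

instance : MeasureTheory.IsProbabilityMeasure (trajLaw η P₁ P₂ ρ h π) := by
  unfold trajLaw
  infer_instance

lemma lintegral_trajLaw_zero (F : Rec K S → ℝ≥0∞) :
    ∫⁻ ω, F (ω 0) ∂trajLaw η P₁ P₂ ρ h π = ∑' r, recLaw η π 0 Fin.elim0 ρ r * F r := by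
  have h0 : (trajLaw η P₁ P₂ ρ h π).map (Preorder.frestrictLe 0) =
      (recLaw η π 0 Fin.elim0 ρ).toMeasure.map (MeasurableEquiv.piUnique _).symm := by
    rw [trajLaw, ProbabilityTheory.Kernel.trajMeasure,
      MeasureTheory.Measure.map_comp _ _ (by fun_prop),
      ProbabilityTheory.Kernel.traj_map_frestrictLe, ProbabilityTheory.Kernel.partialTraj_self,
      MeasureTheory.Measure.id_comp]
  have h1 : ∫⁻ ω, F (ω 0) ∂trajLaw η P₁ P₂ ρ h π =
      ∫⁻ w, F (w ⟨0, by simp⟩) ∂(trajLaw η P₁ P₂ ρ h π).map (Preorder.frestrictLe 0) := by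
    rw [MeasureTheory.lintegral_map Measurable.of_discrete (by fun_prop)]
    rfl
  rw [← lintegral_pmf, h1, h0, MeasureTheory.lintegral_map Measurable.of_discrete (by fun_prop)]
  rfl

lemma lintegral_trajLaw_succ (n : ℕ) (F : ((i : Finset.Iic n) → Rec K S) → Rec K S → ℝ≥0∞) :
    ∫⁻ ω, F (Preorder.frestrictLe n ω) (ω (n + 1)) ∂trajLaw η P₁ P₂ ρ h π =
      ∫⁻ ω, ∑' r, recLaw η π (n + 1) (obsUpTo (n + 1) ω)
        (fun c => armLaw P₁ P₂ h c ((ω n).state c)) r * F (Preorder.frestrictLe n ω) r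
        ∂trajLaw η P₁ P₂ ρ h π := by
  have h0 := ProbabilityTheory.Kernel.map_frestrictLe_trajMeasure_compProd_eq_map_trajMeasure
    (X := fun _ => Rec K S) (κ := stepKernel η P₁ P₂ h π)
    (μ₀ := (recLaw η π 0 Fin.elim0 ρ).toMeasure) (a := n)
  have h1 := congrArg (fun μ => ∫⁻ z, F z.1 z.2 ∂μ) h0
  beta_reduce at h1
  rw [MeasureTheory.Measure.lintegral_compProd Measurable.of_discrete,
    MeasureTheory.lintegral_map Measurable.of_discrete (by fun_prop),
    MeasureTheory.lintegral_map Measurable.of_discrete (by fun_prop)] at h1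
  refine h1.symm.trans ?_
  simp only [← lintegral_pmf]
  rfl

/-- The joint law of the observations up to time `n` and the states of all arms at time `n + 1`. -/
lemma lintegral_obs_state (n : ℕ) : ∀ H : (Fin (n + 1) → Obs K S) → (Fin K → S) → ℝ≥0∞,
    ∫⁻ ω, ∑ y, productLaw (fun c => armLaw P₁ P₂ h c ((ω n).state c)) y *
        H (obsUpTo (n + 1) ω) y ∂trajLaw η P₁ P₂ ρ h π =
      obsExp η π (belief P₁ P₂ ρ h) (n + 1) fun o =>
        ∑ y, productLaw (belief P₁ P₂ ρ h (n + 1) o) y * H o y := by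
  have key : ∀ (m : ℕ) (o : Fin m → Obs K S) (p : Fin K → PMF S)
      (H : (Fin (m + 1) → Obs K S) → (Fin K → S) → ℝ≥0∞),
      ∑ x, productLaw p x * ∑ b, ∑ a, controlLaw η π m o (b, a) *
        ∑ y, productLaw (fun c => armLaw P₁ P₂ h c (x c)) y * H (Fin.snoc o (b, a, x a)) y =
      ∑ b, ∑ a, ∑ z, controlLaw η π m o (b, a) * p a z * ∑ y, productLaw
        (fun c => if c = a then armLaw P₁ P₂ h c z else (p c).bind (armLaw P₁ P₂ h c)) y *
          H (Fin.snoc o (b, a, z)) y := by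
    intro m o p H
    rw [sum_mul_sum_sum]
    refine Finset.sum_congr rfl fun b _ => Finset.sum_congr rfl fun a _ => ?_
    simp only [mul_assoc]
    rw [← Finset.mul_sum, ← sum_productLaw_step p (armLaw P₁ P₂ h) a
      fun z y => H (Fin.snoc o (b, a, z)) y, Finset.mul_sum]
    exact Finset.sum_congr rfl fun x _ => by ring
  induction n with
  | zero =>
    intro H
    have h0 := lintegral_trajLaw_zero η P₁ P₂ ρ h π fun r =>
      ∑ y, productLaw (fun c => armLaw P₁ P₂ h c (r.state c)) y * H (Fin.snoc Fin.elim0 r.obs) y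
    have hobs : ∀ ω : ℕ → Rec K S, obsUpTo (0 + 1) ω = Fin.snoc Fin.elim0 (ω 0).obs := fun ω => by
      rw [obsUpTo_succ]
      congr 1
      exact Subsingleton.elim _ _
    simp only [hobs]
    rw [h0, tsum_recLaw_mul, obsExp_succ]
    refine (key 0 Fin.elim0 ρ H).trans ?_
    simp only [obsExp, obsWeight, one_mul]
    rw [Fintype.sum_subsingleton _ (Fin.elim0 : Fin 0 → Obs K S)]
    simp only [belief_snoc]
    rfl
  | succ n ih =>
    intro H
    have h0 := lintegral_trajLaw_succ η P₁ P₂ ρ h π n fun w r =>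
      ∑ y, productLaw (fun c => armLaw P₁ P₂ h c (r.state c)) y *
        H (Fin.snoc (fun t : Fin (n + 1) => (w ⟨t, Finset.mem_Iic.2 (Nat.lt_succ_iff.1 t.2)⟩).obs)
          r.obs) y
    have hobs : ∀ ω : ℕ → Rec K S, obsUpTo (n + 1 + 1) ω = Fin.snoc
        (fun t : Fin (n + 1) => (Preorder.frestrictLe (π := fun _ => Rec K S) n ω
          ⟨t, Finset.mem_Iic.2 (Nat.lt_succ_iff.1 t.2)⟩).obs) (ω (n + 1)).obs :=
      fun ω => obsUpTo_succ (n + 1) ω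
    simp only [hobs]
    rw [h0]
    simp only [tsum_recLaw_mul]
    have h1 := ih fun o x => ∑ b, ∑ a, controlLaw η π (n + 1) o (b, a) *
        ∑ y, productLaw (fun c => armLaw P₁ P₂ h c (x c)) y * H (Fin.snoc o (b, a, x a)) y
    refine h1.trans ?_
    rw [obsExp_succ _ _ _ (n + 1)]
    simp only [key, belief_snoc]

lemma lintegral_obs (n : ℕ) (F : (Fin n → Obs K S) → ℝ≥0∞) :
    ∫⁻ ω, F (obsUpTo n ω) ∂trajLaw η P₁ P₂ ρ h π = obsExp η π (belief P₁ P₂ ρ h) n F := by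
  cases n with
  | zero =>
    have : ∀ ω : ℕ → Rec K S, obsUpTo 0 ω = Fin.elim0 := fun ω => Subsingleton.elim _ _
    simp only [this, obsExp, obsWeight, one_mul]
    rw [Fintype.sum_subsingleton _ (Fin.elim0 : Fin 0 → Obs K S)]
    simp
  | succ n =>
    have h1 := lintegral_obs_state η P₁ P₂ ρ h π n fun o _ => F o
    simpa only [← Finset.sum_mul, sum_pmf, one_mul] using h1

end Trajectory

end ObservationLaw

/-! ### Stopping -/

section Stopping

variable {K : ℕ} {S : Type*}

/-- The policy stops at time `n` after the given observations. -/
def StopsAt (π : Policy K S) (n : ℕ) (o : Fin n → Obs K S) : Prop := K ≤ n ∧ (π n o).IsStop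

open scoped Classical in
/-- The index that is declared if the policy has stopped before time `n`. -/
def declared (π : Policy K S) : (n : ℕ) → (Fin n → Obs K S) → Option (Fin K)
  | 0, _ => none
  | n + 1, o => (declared π n (Fin.init o)).or
      (if StopsAt π n (Fin.init o) then some (o (Fin.last n)).1 else none)

open scoped Classical in
lemma declared_snoc (π : Policy K S) (n : ℕ) (o : Fin n → Obs K S) (b a : Fin K) (x : S) :
    declared π (n + 1) (Fin.snoc o (b, a, x)) =
      (declared π n o).or (if StopsAt π n o then some b else none) := by
  simp only [declared, Fin.init_snoc, Fin.snoc_last]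

/-- The policy goes on at time `n`. -/
def Live (π : Policy K S) (n : ℕ) (o : Fin n → Obs K S) : Prop :=
  declared π n o = none ∧ ¬StopsAt π n o

lemma declared_snoc_eq_none (π : Policy K S) (n : ℕ) (o : Fin n → Obs K S) (c : Obs K S) :
    declared π (n + 1) (Fin.snoc o c) = none ↔ Live π n o := by
  obtain ⟨b, a, x⟩ := c
  rw [declared_snoc, Live]
  simp [Option.or_eq_none_iff]

lemma declared_obsUpTo_eq_none (π : Policy K S) (n : ℕ) (ω : ℕ → Rec K S) :
    declared π n (obsUpTo n ω) = none ↔ ∀ t < n, ¬StopsAt π t (obsUpTo t ω) := by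
  induction n with
  | zero => simp [declared]
  | succ n ih =>
    rw [obsUpTo_succ, declared_snoc_eq_none, Live, ih]
    simp [Nat.le_iff_lt_or_eq, or_imp, forall_and]

lemma live_obsUpTo (π : Policy K S) (n : ℕ) (ω : ℕ → Rec K S) :
    Live π n (obsUpTo n ω) ↔ ∀ t ≤ n, ¬StopsAt π t (obsUpTo t ω) := by
  rw [Live, declared_obsUpTo_eq_none]
  simp [Nat.le_iff_lt_or_eq, or_imp, forall_and]

lemma lt_stopTime_of_live (π : Policy K S) (n : ℕ) (ω : ℕ → Rec K S)
    (hl : Live π n (obsUpTo n ω)) : (n : ℕ∞) < stopTime π ω := by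
  refine lt_of_lt_of_le (ENat.natCast_lt_natCast.2 n.lt_succ_self) (le_iInf₂ fun t ht => ?_)
  by_contra hlt
  have : t ≤ n := by
    rw [not_le, ENat.natCast_lt_natCast] at hlt
    omega
  exact (live_obsUpTo π n ω).1 hl t this ht

lemma stopTime_eq_of_declared (π : Policy K S) (n : ℕ) (ω : ℕ → Rec K S) (θ : Fin K)
    (hd : declared π n (obsUpTo n ω) = some θ) :
    ∃ t : ℕ, stopTime π ω = t ∧ (ω t).intended = θ := by
  induction n with
  | zero => simp [declared] at hd
  | succ n ih =>
    have h1 : (ω n).obs = ((ω n).intended, (ω n).pulled, (ω n).state (ω n).pulled) := rfl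
    rw [obsUpTo_succ, h1, declared_snoc, Option.or_eq_some_iff] at hd
    rcases hd with hd | ⟨h2, h3⟩
    · exact ih hd
    · split_ifs at h3 with h4
      refine ⟨n, le_antisymm (iInf₂_le n h4) (le_iInf₂ fun t ht => ?_), Option.some.inj h3⟩
      by_contra hlt
      rw [not_le, ENat.natCast_lt_natCast] at hlt
      exact (declared_obsUpTo_eq_none π n ω).1 h2 t hlt ht

variable [Fintype S]

lemma measurable_obsUpTo (n : ℕ) (F : (Fin n → Obs K S) → ℝ≥0∞) :
    Measurable fun ω : ℕ → Rec K S => F (obsUpTo n ω) := by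
  have h1 : Measurable fun (ω : ℕ → Rec K S) (t : Fin n) => ω t := by fun_prop
  have h2 : Measurable fun w : Fin n → Rec K S => F fun t => (w t).obs := Measurable.of_discrete
  exact h2.comp h1

-- This is the tail-sum formula `E τ = ∑ P(τ > n)`; only the inequality is needed.
open scoped Classical in
lemma tsum_live_le_expStopTime (η : Set.Ioc (0 : ℝ) 1) (P₁ P₂ : S → PMF S) (ρ : Fin K → PMF S)
    (h : Fin K) (π : Policy K S) :
    ∑' n, obsExp η π (belief P₁ P₂ ρ h) n (fun o => if Live π n o then 1 else 0) ≤
      expStopTime η P₁ P₂ ρ h π := by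
  simp only [← lintegral_obs]
  rw [← MeasureTheory.lintegral_tsum fun n =>
    (measurable_obsUpTo n fun o => if Live π n o then 1 else 0).aemeasurable]
  refine MeasureTheory.lintegral_mono fun ω => ?_
  calc ∑' n, (if Live π n (obsUpTo n ω) then (1 : ℝ≥0∞) else 0)
      ≤ ∑' n : ℕ, if (n : ℕ∞) < stopTime π ω then 1 else 0 := by
        refine ENNReal.tsum_le_tsum fun n => ?_
        split_ifs with h1 h2
        · exact le_rfl
        · exact absurd (lt_stopTime_of_live π n ω h1) h2
        · exact zero_le_one
        · exact le_rfl
    _ ≤ _ := by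
        induction stopTime π ω using ENat.recTopCoe with
        | top => simp
        | coe N =>
          rw [tsum_eq_sum (s := Finset.range N) fun n hn => if_neg (by simpa using hn)]
          rw [Finset.sum_congr rfl fun n hn => if_pos (by simpa using hn)]
          simp

open scoped Classical in
lemma obsExp_declared_le_errorProb (η : Set.Ioc (0 : ℝ) 1) (P₁ P₂ : S → PMF S)
    (ρ : Fin K → PMF S) (h : Fin K) (π : Policy K S) (n : ℕ) :
    obsExp η π (belief P₁ P₂ ρ h) n
      (fun o => if ∃ θ, θ ≠ h ∧ declared π n o = some θ then 1 else 0) ≤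
      errorProb η P₁ P₂ ρ h π := by
  rw [← lintegral_obs]
  refine le_trans (MeasureTheory.lintegral_mono
    (g := Set.indicator {ω | ∃ t : ℕ, stopTime π ω = t ∧ (ω t).intended ≠ h} fun _ => 1)
    fun ω => ?_) ((MeasureTheory.lintegral_indicator_const_le _ _).trans (one_mul _).le)
  dsimp only
  split_ifs with h1
  · obtain ⟨θ, hθ, hd⟩ := h1
    obtain ⟨t, ht, hi⟩ := stopTime_eq_of_declared π n ω θ hd
    rw [Set.indicator_of_mem]
    exact ⟨t, ht, hi ▸ hθ⟩
  · exact zero_le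

end Stopping

/-! ### Occupation of the delay chain under a policy -/

section Occupation

variable {K : ℕ} {S : Type*}

/-- The delays and last observed states after the given observations. -/
def delayState (s₀ : DState K S) : (n : ℕ) → (Fin n → Obs K S) → DState K S
  | 0, _ => s₀
  | n + 1, o => (delayState s₀ n (Fin.init o)).pull (o (Fin.last n)).2.1 (o (Fin.last n)).2.2

lemma delayState_snoc (s₀ : DState K S) (n : ℕ) (o : Fin n → Obs K S) (b a : Fin K) (x : S) :
    delayState s₀ (n + 1) (Fin.snoc o (b, a, x)) = (delayState s₀ n o).pull a x := by
  simp only [delayState, Fin.init_snoc, Fin.snoc_last]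

lemma controlLaw_of_lt (η : Set.Ioc (0 : ℝ) 1) (π : Policy K S) {n : ℕ} (hn : n < K)
    (o : Fin n → Obs K S) {b a : Fin K} (h : controlLaw η π n o (b, a) ≠ 0) : a = ⟨n, hn⟩ := by
  rw [controlLaw, dif_pos hn] at h
  by_contra ha
  exact h (by simp [ha])

lemma controlLaw_of_ge (η : Set.Ioc (0 : ℝ) 1) (π : Policy K S) {n : ℕ} (hn : K ≤ n)
    (o : Fin n → Obs K S) (b a : Fin K) :
    controlLaw η π n o (b, a) = (π n o).dist b * tremble η b a := by
  classical
  rw [controlLaw, dif_neg (not_lt.2 hn), PMF.bind_apply, tsum_eq_single b]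
  · rw [PMF.map_apply, tsum_eq_single a]
    · simp
    · intro a' ha'
      simp [ha'.symm]
  · intro b' hb'
    rw [PMF.map_apply]
    simp [hb'.symm]

/-- Once an arm has been pulled, its belief is determined by its delay and last observed state. -/
lemma belief_eq_nStep (η : Set.Ioc (0 : ℝ) 1) (π : Policy K S) (bel : Belief K S)
    (P₁ P₂ : S → PMF S) (ρ : Fin K → PMF S) (h : Fin K) (s₀ : DState K S) (n : ℕ) :
    ∀ o, obsWeight η π bel n o ≠ 0 → ∀ c : Fin K, c.val < n →
      belief P₁ P₂ ρ h n o c = nStep (armLaw P₁ P₂ h c) ((delayState s₀ n o).delay c)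
        ((delayState s₀ n o).last c) := by
  induction n with
  | zero => intro _ _ c hc; omega
  | succ n ih =>
    intro o ho c hc
    rw [obsWeight] at ho
    have h1 := left_ne_zero_of_mul ho
    have h2 := left_ne_zero_of_mul (right_ne_zero_of_mul ho)
    simp only [belief, delayState, DState.pull]
    by_cases hca : c = (o (Fin.last n)).2.1
    · simp only [hca, if_true, nStep_one]
    · simp only [hca, if_false]
      have hcn : c.val < n := by
        by_contra hge
        have hcn : c.val = n := by omega
        have := controlLaw_of_lt η π (hcn ▸ c.2) _ h2
        exact hca (this ▸ Fin.ext hcn)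
      rw [ih _ h1 c hcn]
      rfl

variable [Fintype S] (η : Set.Ioc (0 : ℝ) 1) (P₁ P₂ : S → PMF S) (ρ : Fin K → PMF S) (h : Fin K)
  (π : Policy K S) (s₀ : DState K S)

open scoped Classical in
/-- The expected number of times before stopping at which the delays and last observed states are
`s` and arm `b` is intended. -/
def policyOcc (s : DState K S) (b : Fin K) : ℝ≥0∞ :=
  ∑' t, obsExp η π (belief P₁ P₂ ρ h) (K + t) fun o =>
    if Live π (K + t) o then (π (K + t) o).dist b * (if delayState s₀ (K + t) o = s then 1 else 0)
    else 0

open scoped Classical in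
lemma tsum_policyOcc_mul (g : DState K S → Fin K → ℝ≥0∞) :
    ∑' s, ∑ b, policyOcc η P₁ P₂ ρ h π s₀ s b * g s b =
      ∑' t, obsExp η π (belief P₁ P₂ ρ h) (K + t) fun o =>
        if Live π (K + t) o then ∑ b, (π (K + t) o).dist b * g (delayState s₀ (K + t) o) b
        else 0 := by
  simp only [policyOcc, obsExp, ← ENNReal.tsum_mul_right]
  simp_rw [← Summable.tsum_finsetSum fun _ _ => ENNReal.summable]
  rw [ENNReal.tsum_comm]
  refine tsum_congr fun t => ?_
  simp only [Finset.sum_mul]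
  simp_rw [Finset.sum_comm (s := (Finset.univ : Finset (Fin K)))]
  rw [Summable.tsum_finsetSum fun _ _ => ENNReal.summable]
  refine Finset.sum_congr rfl fun o _ => ?_
  rw [tsum_eq_single (delayState s₀ (K + t) o)]
  · by_cases hl : Live π (K + t) o
    · simp only [hl, if_true, mul_one, Finset.mul_sum, mul_assoc]
    · simp [hl]
  · intro s hs
    simp [hs.symm]

open scoped Classical in
lemma tsum_sum_policyOcc :
    ∑' s, ∑ b, policyOcc η P₁ P₂ ρ h π s₀ s b =
      ∑' t, obsExp η π (belief P₁ P₂ ρ h) (K + t) fun o => if Live π (K + t) o then 1 else 0 := by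
  simpa [sum_pmf] using tsum_policyOcc_mul η P₁ P₂ ρ h π s₀ fun _ _ => 1

lemma tsum_sum_policyOcc_le :
    ∑' s, ∑ b, policyOcc η P₁ P₂ ρ h π s₀ s b ≤ expStopTime η P₁ P₂ ρ h π := by
  classical
  rw [tsum_sum_policyOcc]
  refine le_trans ?_ (tsum_live_le_expStopTime η P₁ P₂ ρ h π)
  exact ENNReal.tsum_comp_le_tsum_of_injective (add_right_injective K)
    fun n => obsExp η π (belief P₁ P₂ ρ h) n fun o => if Live π n o then 1 else 0

-- Disintegration along the first coordinate; it produces the stationary strategy that imitates a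
-- policy. Where the marginal vanishes the conditional law is arbitrary.
omit [Fintype S] in
lemma exists_conditional {X ι : Type*} [Fintype ι] [Nonempty ι] (f : X → ι → ℝ≥0∞)
    (hf : ∀ x, ∑ i, f x i ≠ ∞) :
    ∃ lam : X → PMF ι, ∀ x i, (∑ j, f x j) * lam x i = f x i := by
  obtain ⟨i₀⟩ := ‹Nonempty ι›
  have key : ∀ x, ∃ p : PMF ι, ∀ i, (∑ j, f x j) * p i = f x i := by
    intro x
    by_cases h0 : ∑ j, f x j = 0
    · refine ⟨PMF.pure i₀, fun i => ?_⟩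
      rw [h0, zero_mul, Finset.sum_eq_zero_iff.1 h0 i (Finset.mem_univ i)]
    · refine ⟨PMF.ofFintype (fun i => (∑ j, f x j)⁻¹ * f x i) ?_, fun i => ?_⟩
      · rw [← Finset.mul_sum, ENNReal.inv_mul_cancel h0 (hf x)]
      · rw [PMF.ofFintype_apply, ← mul_assoc, ENNReal.mul_inv_cancel h0 (hf x), one_mul]
  choose lam hlam using key
  exact ⟨lam, hlam⟩

omit [Fintype S] in
lemma mul_pullProb_eq (lam : SRS K S) {f : DState K S → Fin K → ℝ≥0∞}
    (hlam : ∀ s b, (∑ c, f s c) * lam s b = f s b) (s : DState K S) (a : Fin K) :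
    (∑ b, f s b) * pullProb η lam s a = ∑ b, f s b * tremble η b a := by
  have h0 := η.2.1.le
  have h1 : (0 : ℝ) ≤ 1 - η := sub_nonneg.2 η.2.2
  have ht : ∀ b, tremble η b a = ENNReal.ofReal ((η : ℝ) / K) +
      ENNReal.ofReal (1 - η) * if b = a then 1 else 0 := by
    intro b
    rw [tremble, PMF.ofFintype_apply, trembleProb, ENNReal.ofReal_add (by positivity)
      (by split_ifs <;> simp [h1]), ENNReal.ofReal_mul h1]
    simp only [eq_comm (a := a)]
    split_ifs <;> simp
  simp only [ht, pullProb, mul_add, Finset.sum_add_distrib, ← Finset.sum_mul]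
  congr 1
  rw [mul_left_comm, hlam]
  simp [mul_comm]

variable [DecidableEq S]

open scoped Classical in
/-- The occupation measure of a policy is stationary up to its starting point. -/
lemma sum_policyOcc_le (lam : SRS K S)
    (hlam : ∀ s b, (∑ c, policyOcc η P₁ P₂ ρ h π s₀ s c) * lam s b =
      policyOcc η P₁ P₂ ρ h π s₀ s b) (s' : DState K S) :
    ∑ b, policyOcc η P₁ P₂ ρ h π s₀ s' b ≤
      ∑' s, (∑ b, policyOcc η P₁ P₂ ρ h π s₀ s b) * delayKer η P₁ P₂ h lam s s' +
        obsExp η π (belief P₁ P₂ ρ h) K fun o => if delayState s₀ K o = s' then 1 else 0 := by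
  have h1 : ∑ b, policyOcc η P₁ P₂ ρ h π s₀ s' b = ∑' t, obsExp η π (belief P₁ P₂ ρ h) (K + t)
      fun o => if Live π (K + t) o then (if delayState s₀ (K + t) o = s' then 1 else 0)
        else 0 := by
    have := tsum_policyOcc_mul η P₁ P₂ ρ h π s₀ fun s _ => if s = s' then 1 else 0
    simp only [← Finset.sum_mul, sum_pmf, one_mul] at this
    rw [← this, tsum_eq_single s']
    · simp
    · intro s hs
      simp [hs]
  have h2 : ∑' s, (∑ b, policyOcc η P₁ P₂ ρ h π s₀ s b) * delayKer η P₁ P₂ h lam s s' =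
      ∑' t, obsExp η π (belief P₁ P₂ ρ h) (K + t) fun o => if Live π (K + t) o then
        ∑ b, (π (K + t) o).dist b * ∑ a, tremble η b a *
          pullTrans P₁ P₂ h (delayState s₀ (K + t) o) a s' else 0 := by
    rw [← tsum_policyOcc_mul η P₁ P₂ ρ h π s₀ fun s b => ∑ a, tremble η b a *
          pullTrans P₁ P₂ h s a s']
    refine tsum_congr fun s => ?_
    simp only [delayKer, Finset.mul_sum, ← mul_assoc]
    rw [Finset.sum_comm]
    refine Finset.sum_congr rfl fun a _ => ?_
    rw [← Finset.sum_mul, ← mul_pullProb_eq η lam hlam]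
  -- The term `t = 0` is the defect. Each term `t + 1` is bounded by one kernel step from `t`, with
  -- a loss exactly where the policy stops.
  rw [h1, h2, tsum_eq_zero_add' ENNReal.summable, add_comm]
  refine add_le_add (ENNReal.tsum_le_tsum fun t => ?_) (obsExp_mono _ _ _ _ fun o _ => ?_)
  · rw [← add_assoc, obsExp_succ]
    refine obsExp_mono _ _ _ _ fun o ho => ?_
    split_ifs with hl
    · refine Finset.sum_le_sum fun b _ => ?_
      rw [Finset.mul_sum]
      refine Finset.sum_le_sum fun a _ => ?_
      rw [pullTrans_eq_sum, ← mul_assoc, Finset.mul_sum]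
      refine Finset.sum_le_sum fun x _ => ?_
      rw [controlLaw_of_ge η π (by omega), belief_eq_nStep η π _ P₁ P₂ ρ h s₀ _ o ho a (by omega),
        delayState_snoc, mul_assoc]
      refine mul_le_mul_right (mul_le_mul_right ?_ _) _
      split_ifs <;> simp
    · refine le_of_eq (Finset.sum_eq_zero fun b _ => Finset.sum_eq_zero fun a _ =>
        Finset.sum_eq_zero fun x _ => ?_)
      rw [if_neg, mul_zero]
      exact fun h3 => hl ((declared_snoc_eq_none π _ o _).1 h3.1)
  · change _ ≤ if delayState s₀ (K + 0) o = s' then (1 : ℝ≥0∞) else 0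
    split_ifs <;> simp

end Occupation

/-! ### Change of measure at the stopping time -/

section ChangeOfMeasure

variable {K : ℕ} {S : Type*} [Fintype S]

open scoped Classical in
/-- The log-likelihood ratio of two beliefs, accumulated until the policy stops. -/
def logRatio (π : Policy K S) (bel bel' : Belief K S) : (n : ℕ) → (Fin n → Obs K S) → ℝ
  | 0, _ => 0
  | n + 1, o => logRatio π bel bel' n (Fin.init o) + if Live π n (Fin.init o) then
      Real.log ((bel n (Fin.init o) (o (Fin.last n)).2.1 (o (Fin.last n)).2.2).toReal /
        (bel' n (Fin.init o) (o (Fin.last n)).2.1 (o (Fin.last n)).2.2).toReal) else 0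

omit [Fintype S] in
open scoped Classical in
lemma logRatio_snoc (π : Policy K S) (bel bel' : Belief K S) (n : ℕ) (o : Fin n → Obs K S)
    (b a : Fin K) (x : S) : logRatio π bel bel' (n + 1) (Fin.snoc o (b, a, x)) =
      logRatio π bel bel' n o + if Live π n o then
        Real.log ((bel n o a x).toReal / (bel' n o a x).toReal) else 0 := by
  simp only [logRatio, Fin.init_snoc, Fin.snoc_last]

open scoped Classical in
/-- The belief that follows `bel'` until the policy stops and `bel` afterwards. -/
def switchBelief (π : Policy K S) (bel bel' : Belief K S) : Belief K S := fun n o =>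
  if Live π n o then bel' n o else bel n o

-- Only an inequality, since observations that are null under `bel` may have positive weight under
-- `bel'`. The comparison is with `switchBelief` because the log-ratio is frozen once the policy
-- stops.
omit [Fintype S] in
lemma obsWeight_mul_exp_le (η : Set.Ioc (0 : ℝ) 1) (π : Policy K S) {bel bel' : Belief K S}
    (hac : ∀ n o c y, bel n o c y ≠ 0 → bel' n o c y ≠ 0) (n : ℕ) : ∀ o : Fin n → Obs K S,
    obsWeight η π bel n o * ENNReal.ofReal (Real.exp (-logRatio π bel bel' n o)) ≤
      obsWeight η π (switchBelief π bel bel') n o := by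
  classical
  induction n with
  | zero => intro o; simp [obsWeight, logRatio]
  | succ n ih =>
    intro o
    simp only [obsWeight, logRatio]
    set o' : Fin n → Obs K S := Fin.init o
    obtain ⟨b, a, x⟩ := o (Fin.last n)
    dsimp only
    have key : bel n o' a x * ENNReal.ofReal (Real.exp (-if Live π n o' then
        Real.log ((bel n o' a x).toReal / (bel' n o' a x).toReal) else 0)) ≤
        switchBelief π bel bel' n o' a x := by
      unfold switchBelief
      split_ifs with hl
      · rcases eq_or_ne (bel n o' a x) 0 with h0 | h0
        · simp [h0]
        · have hp := ENNReal.toReal_pos h0 (PMF.apply_ne_top _ _)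
          have hq := ENNReal.toReal_pos (hac _ _ _ _ h0) (PMF.apply_ne_top _ _)
          rw [Real.exp_neg, Real.exp_log (div_pos hp hq), inv_div,
            ENNReal.ofReal_div_of_pos hp, ENNReal.ofReal_toReal (PMF.apply_ne_top _ _),
            ENNReal.ofReal_toReal (PMF.apply_ne_top _ _)]
          exact ENNReal.mul_div_le
      · simp
    rw [neg_add, Real.exp_add, ENNReal.ofReal_mul (Real.exp_pos _).le]
    calc _ = (obsWeight η π bel n o' *
            ENNReal.ofReal (Real.exp (-logRatio π bel bel' n o'))) *
          (controlLaw η π n o' (b, a) * (bel n o' a x * ENNReal.ofReal (Real.exp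
            (-if Live π n o' then Real.log ((bel n o' a x).toReal / (bel' n o' a x).toReal)
              else 0)))) := by ring
      _ ≤ _ := mul_le_mul' (ih o') (mul_le_mul_right key _)

omit [Fintype S] in
lemma obsWeight_switchBelief (η : Set.Ioc (0 : ℝ) 1) (π : Policy K S) (bel bel' : Belief K S)
    (n : ℕ) : ∀ o : Fin n → Obs K S, declared π n o = none →
      obsWeight η π (switchBelief π bel bel') n o = obsWeight η π bel' n o := by
  induction n with
  | zero => intro o _; rfl
  | succ n ih =>
    intro o ho
    rw [← Fin.snoc_init_self o, declared_snoc_eq_none] at ho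
    simp only [obsWeight]
    rw [ih _ ho.1, switchBelief, if_pos ho]

-- The declared index is drawn by the control before any state is observed at the stopping time, so
-- the belief at that time sums out.
open scoped Classical in
lemma obsExp_declared_succ (η : Set.Ioc (0 : ℝ) 1) (π : Policy K S) (bel : Belief K S)
    (θ : Fin K) (n : ℕ) :
    obsExp η π bel (n + 1) (fun o => if declared π (n + 1) o = some θ then 1 else 0) =
      obsExp η π bel n (fun o => if declared π n o = some θ then 1 else 0) +
      obsExp η π bel n (fun o => if declared π n o = none ∧ StopsAt π n o then
        ∑ a, controlLaw η π n o (θ, a) else 0) := by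
  rw [← obsExp_add, obsExp_succ]
  congr 1
  funext o
  simp only [declared_snoc]
  rcases hd : declared π n o with _ | θ'
  · by_cases hs : StopsAt π n o
    · simp only [hs, if_true, Option.none_or, and_self, Option.some.injEq, mul_ite, mul_one,
        mul_zero]
      rw [Finset.sum_eq_single θ]
      · simp [← Finset.mul_sum, sum_pmf]
      · intro b _ hb
        simp [hb]
      · simp
    · simp [hs]
  · by_cases hθ : θ' = θ
    · simp [hθ, sum_controlLaw_mul]
    · simp [hθ]

-- The two beliefs differ only once the policy has stopped, and by then the declaration is
-- independent of the belief; so the error bound under `bel'` transfers to the switched law.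
open scoped Classical in
lemma obsExp_switchBelief_declared (η : Set.Ioc (0 : ℝ) 1) (π : Policy K S)
    (bel bel' : Belief K S) (θ : Fin K) (n : ℕ) :
    obsExp η π (switchBelief π bel bel') n (fun o => if declared π n o = some θ then 1 else 0) =
      obsExp η π bel' n (fun o => if declared π n o = some θ then 1 else 0) := by
  induction n with
  | zero => simp [obsExp, declared]
  | succ n ih =>
    rw [obsExp_declared_succ, obsExp_declared_succ, ih]
    congr 1
    refine Finset.sum_congr rfl fun o _ => ?_
    by_cases hd : declared π n o = none
    · rw [obsWeight_switchBelief η π bel bel' n o hd]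
    · simp [hd]

/-- Real-valued expectation of a function of the observations. -/
def obsMean (η : Set.Ioc (0 : ℝ) 1) (π : Policy K S) (bel : Belief K S) (n : ℕ)
    (f : (Fin n → Obs K S) → ℝ) : ℝ :=
  ∑ o, (obsWeight η π bel n o).toReal * f o

lemma obsMean_eq_toReal (η : Set.Ioc (0 : ℝ) 1) (π : Policy K S) (bel : Belief K S) (n : ℕ)
    (F : (Fin n → Obs K S) → ℝ≥0∞) (hF : ∀ o, F o ≠ ∞) :
    obsMean η π bel n (fun o => (F o).toReal) = (obsExp η π bel n F).toReal := by
  rw [obsExp, ENNReal.toReal_sum fun o _ => ENNReal.mul_ne_top (obsWeight_ne_top η π bel n o) (hF o)]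
  simp only [ENNReal.toReal_mul, obsMean]

open scoped Classical in
/-- If under `bel'` the index `θ` is declared with probability at most `ε`, then the mean
log-likelihood ratio at the stopping time under `bel` is large. -/
lemma le_obsMean_logRatio (η : Set.Ioc (0 : ℝ) 1) (π : Policy K S) {bel bel' : Belief K S}
    (hac : ∀ n o c y, bel n o c y ≠ 0 → bel' n o c y ≠ 0) (n : ℕ) (θ : Fin K) {ε : ℝ}
    (hε : 0 < ε)
    (herr : obsExp η π bel' n (fun o => if declared π n o = some θ then 1 else 0) ≤
      ENNReal.ofReal ε) :
    Real.log (1 / ε) * (obsExp η π bel n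
      (fun o => if declared π n o = some θ then 1 else 0)).toReal - 1 ≤
      obsMean η π bel n (logRatio π bel bel' n) := by
  set I : (Fin n → Obs K S) → ℝ := fun o => if declared π n o = some θ then 1 else 0 with hI
  set E : (Fin n → Obs K S) → ℝ≥0∞ := fun o => if declared π n o = some θ then 1 else 0 with hE
  set z := logRatio π bel bel' n
  have hEI : ∀ o, (E o).toReal = I o := fun o => by simp only [hE, hI]; split_ifs <;> simp
  have hEt : ∀ o, E o ≠ ∞ := fun o => by simp only [hE]; split_ifs <;> simp
  -- This is `log x ≤ x - 1` at `x = exp (-z) * (I / ε + 1)`. In the mean, `exp (-z) * I / ε` and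
  -- `exp (-z)` contribute at most one each, which leaves the loss of `1`.
  have hpt : ∀ o, Real.log (1 / ε) * I o + 1 - Real.exp (-z o) * (ε⁻¹ * I o + 1) ≤ z o := by
    intro o
    have hI0 : 0 ≤ I o := by simp only [hI]; split_ifs <;> simp
    have h1 : 0 < ε⁻¹ * I o + 1 := by positivity
    have h2 := Real.log_le_sub_one_of_pos (mul_pos (Real.exp_pos (-z o)) h1)
    rw [Real.log_mul (Real.exp_pos _).ne' h1.ne', Real.log_exp] at h2
    have h3 : Real.log (1 / ε) * I o ≤ Real.log (ε⁻¹ * I o + 1) := by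
      simp only [hI]
      split_ifs
      · rw [mul_one, mul_one, one_div]
        exact Real.log_le_log (inv_pos.2 hε) (by linarith)
      · simp
    linarith
  have hle : ∀ F : (Fin n → Obs K S) → ℝ≥0∞,
      obsExp η π bel n (fun o => ENNReal.ofReal (Real.exp (-z o)) * F o) ≤
        obsExp η π (switchBelief π bel bel') n F := fun F =>
    Finset.sum_le_sum fun o _ => by
      rw [← mul_assoc]
      exact mul_le_mul_left (obsWeight_mul_exp_le η π hac n o) _
  have hm1 : obsMean η π bel n (fun o => Real.exp (-z o)) ≤ 1 := by
    have h1 := hle fun _ => 1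
    rw [obsExp_one] at h1
    have h2 := obsMean_eq_toReal η π bel n (fun o => ENNReal.ofReal (Real.exp (-z o)) * 1)
      fun o => by simp
    simp only [mul_one, ENNReal.toReal_ofReal (Real.exp_pos _).le] at h1 h2
    rw [h2]
    exact ENNReal.toReal_le_of_le_ofReal zero_le_one (by simpa using h1)
  have hm2 : obsMean η π bel n (fun o => Real.exp (-z o) * I o) ≤ ε := by
    have h1 := hle E
    rw [obsExp_switchBelief_declared] at h1
    have h2 := obsMean_eq_toReal η π bel n (fun o => ENNReal.ofReal (Real.exp (-z o)) * E o)
      fun o => ENNReal.mul_ne_top ENNReal.ofReal_ne_top (hEt o)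
    simp only [ENNReal.toReal_mul, ENNReal.toReal_ofReal (Real.exp_pos _).le, hEI] at h2
    rw [h2]
    exact ENNReal.toReal_le_of_le_ofReal hε.le (h1.trans herr)
  have hm3 : obsMean η π bel n (fun _ => 1) = 1 := by
    simpa [obsExp_one] using obsMean_eq_toReal η π bel n (fun _ => 1) (by simp)
  rw [← obsMean_eq_toReal η π bel n E hEt]
  simp only [hEI]
  have hsum : Real.log (1 / ε) * obsMean η π bel n I + obsMean η π bel n (fun _ => 1) -
      (ε⁻¹ * obsMean η π bel n (fun o => Real.exp (-z o) * I o) +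
        obsMean η π bel n (fun o => Real.exp (-z o))) ≤ obsMean η π bel n z := by
    simp only [obsMean, Finset.mul_sum, ← Finset.sum_add_distrib, ← Finset.sum_sub_distrib]
    refine Finset.sum_le_sum fun o _ => ?_
    refine le_trans (le_of_eq ?_) (mul_le_mul_of_nonneg_left (hpt o) ENNReal.toReal_nonneg)
    ring
  have h4 : ε⁻¹ * obsMean η π bel n (fun o => Real.exp (-z o) * I o) ≤ 1 := by
    calc _ ≤ ε⁻¹ * ε := mul_le_mul_of_nonneg_left hm2 (inv_pos.2 hε).le
      _ = 1 := inv_mul_cancel₀ hε.ne'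
  linarith

lemma ofReal_sum_le {ι : Type*} (s : Finset ι) (f : ι → ℝ) :
    ENNReal.ofReal (∑ i ∈ s, f i) ≤ ∑ i ∈ s, ENNReal.ofReal (f i) :=
  Finset.le_sum_of_subadditive ENNReal.ofReal (by simp) (fun _ _ => ENNReal.ofReal_add_le) s f

lemma ofReal_toReal_mul {p : ℝ≥0∞} (hp : p ≠ ∞) (x : ℝ) :
    ENNReal.ofReal (p.toReal * x) = p * ENNReal.ofReal x := by
  rw [ENNReal.ofReal_mul ENNReal.toReal_nonneg, ENNReal.ofReal_toReal hp]

open scoped Classical in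
/-- The mean log-likelihood ratio is a sum of relative entropies of the beliefs. -/
lemma ofReal_obsMean_logRatio_le (η : Set.Ioc (0 : ℝ) 1) (π : Policy K S) (bel bel' : Belief K S)
    (n : ℕ) :
    ENNReal.ofReal (obsMean η π bel n (logRatio π bel bel' n)) ≤
      ∑ t ∈ Finset.range n, obsExp η π bel t fun o => if Live π t o then
        ∑ b, ∑ a, controlLaw η π t o (b, a) * ENNReal.ofReal
          (klFin (fun x => (bel t o a x).toReal) (fun x => (bel' t o a x).toReal)) else 0 := by
  induction n with
  | zero => simp [obsMean, logRatio]
  | succ n ih =>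
    have h1 : obsMean η π bel (n + 1) (logRatio π bel bel' (n + 1)) =
        obsMean η π bel n (logRatio π bel bel' n) + ∑ o, (obsWeight η π bel n o).toReal *
          if Live π n o then ∑ b, ∑ a, (controlLaw η π n o (b, a)).toReal *
            klFin (fun x => (bel n o a x).toReal) (fun x => (bel' n o a x).toReal) else 0 := by
      simp only [obsMean]
      rw [sum_snoc, ← Finset.sum_add_distrib]
      refine Finset.sum_congr rfl fun o _ => ?_
      simp only [obsWeight_snoc, logRatio_snoc, ENNReal.toReal_mul, mul_assoc, ← Finset.mul_sum,
        mul_add, Finset.sum_add_distrib, ← Finset.sum_mul, sum_pmf_toReal, one_mul]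
      have h2 : ∑ b, ∑ a, (controlLaw η π n o (b, a)).toReal = 1 := by
        rw [← Fintype.sum_prod_type' fun b a => (controlLaw η π n o (b, a)).toReal]
        exact sum_pmf_toReal _
      rw [h2, one_mul]
      split_ifs
      · rfl
      · simp
    rw [h1, Finset.sum_range_succ]
    refine ENNReal.ofReal_add_le.trans (add_le_add ih ((ofReal_sum_le _ _).trans ?_))
    refine Finset.sum_le_sum fun o _ => ?_
    rw [ofReal_toReal_mul (obsWeight_ne_top η π bel n o)]
    refine mul_le_mul_right ?_ _
    dsimp only
    split_ifs
    · refine (ofReal_sum_le _ _).trans (Finset.sum_le_sum fun b _ =>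
        (ofReal_sum_le _ _).trans (Finset.sum_le_sum fun a _ => ?_))
      rw [ofReal_toReal_mul (PMF.apply_ne_top _ _)]
    · simp

end ChangeOfMeasure

/-! ### The lower bound -/

section LowerBound

variable {K : ℕ} {S : Type*} {P₁ P₂ : S → PMF S} (hac : ∀ i j, 0 < P₁ i j ↔ 0 < P₂ i j)

include hac in
lemma armLaw_ne_zero (h h' c : Fin K) (i j : S) (hij : armLaw P₁ P₂ h c i j ≠ 0) :
    armLaw P₁ P₂ h' c i j ≠ 0 := by
  have := hac i j
  simp only [pos_iff_ne_zero] at this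
  unfold armLaw at hij ⊢
  split_ifs at hij ⊢ <;> tauto

lemma bind_ne_zero_of {α β : Type*} {p q : PMF α} {f g : α → PMF β}
    (hpq : ∀ x, p x ≠ 0 → q x ≠ 0) (hfg : ∀ x y, f x y ≠ 0 → g x y ≠ 0) (y : β)
    (hy : p.bind f y ≠ 0) : q.bind g y ≠ 0 := by
  rw [PMF.bind_apply, Ne, ENNReal.tsum_eq_zero, not_forall] at hy ⊢
  obtain ⟨x, hx⟩ := hy
  exact ⟨x, mul_ne_zero (hpq x (left_ne_zero_of_mul hx)) (hfg x y (right_ne_zero_of_mul hx))⟩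

lemma nStep_ne_zero_of {P Q : S → PMF S} (hPQ : ∀ x y, P x y ≠ 0 → Q x y ≠ 0) (d : ℕ) (i : S) :
    ∀ y, nStep P d i y ≠ 0 → nStep Q d i y ≠ 0 := by
  induction d with
  | zero => exact fun y hy => hy
  | succ d ih => exact fun y hy => bind_ne_zero_of ih hPQ y hy

include hac in
lemma belief_ne_zero (ρ : Fin K → PMF S) (h h' : Fin K) (n : ℕ) : ∀ o c y,
    belief P₁ P₂ ρ h n o c y ≠ 0 → belief P₁ P₂ ρ h' n o c y ≠ 0 := by
  induction n with
  | zero => exact fun o c y hy => hy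
  | succ n ih =>
    intro o c y hy
    simp only [belief] at hy ⊢
    split_ifs at hy ⊢ with hc
    · exact armLaw_ne_zero hac h h' c _ y hy
    · exact bind_ne_zero_of (ih _ c) (armLaw_ne_zero hac h h' c) y hy

/-- Needed for the first `K` observations, when the predictive law of an arm not yet seen still
depends on `ρ`. Each unobserved step costs at most one factor `β`. -/
lemma exists_pow_le_belief [Finite S] (ρ : Fin K → PMF S) : ∃ β : ℝ≥0∞, β ≠ 0 ∧ β ≤ 1 ∧
    ∀ h n o c y, belief P₁ P₂ ρ h n o c y ≠ 0 → β ^ (n + 1) ≤ belief P₁ P₂ ρ h n o c y := by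
  obtain ⟨β₀, h0, h0', hβ₀⟩ := exists_pos_le_of_ne_zero fun x : Fin K × S => ρ x.1 x.2
  obtain ⟨β₁, h1, -, hβ₁⟩ := exists_pos_le_of_ne_zero
    fun x : Fin K × Fin K × S × S => armLaw P₁ P₂ x.1 x.2.1 x.2.2.1 x.2.2.2
  have hle : min β₀ β₁ ≤ 1 := (min_le_left _ _).trans h0'
  refine ⟨min β₀ β₁, ?_, hle, fun h n => ?_⟩
  · rw [← pos_iff_ne_zero, lt_min_iff]
    exact ⟨pos_iff_ne_zero.2 h0, pos_iff_ne_zero.2 h1⟩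
  · have harm : ∀ c i j, armLaw P₁ P₂ h c i j ≠ 0 → min β₀ β₁ ≤ armLaw P₁ P₂ h c i j :=
      fun c i j hij => (min_le_right _ _).trans (hβ₁ (h, c, i, j) hij)
    induction n with
    | zero =>
      intro o c y hy
      rw [zero_add, pow_one]
      exact (min_le_left _ _).trans (hβ₀ (c, y) hy)
    | succ n ih =>
      intro o c y hy
      simp only [belief] at hy ⊢
      split_ifs at hy ⊢ with hc
      · exact (pow_le_of_le_one zero_le hle (by omega)).trans (harm _ _ _ hy)
      · rw [PMF.bind_apply, Ne, ENNReal.tsum_eq_zero, not_forall] at hy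
        obtain ⟨x, hx⟩ := hy
        rw [PMF.bind_apply, pow_succ]
        exact (mul_le_mul' (ih _ c x (left_ne_zero_of_mul hx))
          (harm c x y (right_ne_zero_of_mul hx))).trans (ENNReal.le_tsum x)

variable [Fintype S] [DecidableEq S]

-- On the common support the denominators are at least `β`, uniformly in the delay. This supplies
-- the bounded cost required by the Poisson estimate.
include hac in
lemma kDiv_le {β : ℝ≥0∞} (hβ : β ≠ 0) (hβ1 : β ≤ 1)
    (hb : ∀ h c : Fin K, ∀ d i j, nStep (armLaw P₁ P₂ h c) d i j ≠ 0 →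
      β ≤ nStep (armLaw P₁ P₂ h c) d i j) {h h' : Fin K} (hne : h' ≠ h) (s : DState K S)
    (a : Fin K) : kDiv P₁ P₂ h h' s a ≤ -Real.log β.toReal := by
  have key : ∀ g g' c : Fin K,
      klFin (stepProb (armLaw P₁ P₂ g c) (s.delay a) (s.last a))
        (stepProb (armLaw P₁ P₂ g' c) (s.delay a) (s.last a)) ≤ -Real.log β.toReal := by
    intro g g' c
    have := klFin_le (nStep (armLaw P₁ P₂ g c) (s.delay a) (s.last a))
      (nStep (armLaw P₁ P₂ g' c) (s.delay a) (s.last a)) hβ fun y hy =>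
        hb g' c _ _ _ (nStep_ne_zero_of (armLaw_ne_zero hac g g' c) _ _ y hy)
    simpa only [nStep_toReal] using this
  unfold kDiv
  split_ifs
  · simpa [armLaw, hne.symm] using key h h' h
  · simpa [armLaw, hne] using key h h' h'
  · exact neg_nonneg.2 (Real.log_nonpos ENNReal.toReal_nonneg
      (by simpa using ENNReal.toReal_mono ENNReal.one_ne_top hβ1))

omit [DecidableEq S] in
lemma klFin_self (p : S → ℝ) : klFin p p = 0 :=
  Finset.sum_eq_zero fun y _ => by
    rcases eq_or_ne (p y) 0 with h0 | h0
    · simp [h0]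
    · simp [div_self h0]

/-- After all arms have been pulled, the relative entropy of the beliefs is `kDiv`. -/
lemma klFin_belief (η : Set.Ioc (0 : ℝ) 1) (π : Policy K S) (bel : Belief K S)
    (ρ : Fin K → PMF S) {h h' : Fin K} (hne : h' ≠ h) (s₀ : DState K S) {n : ℕ} (hn : K ≤ n)
    (o : Fin n → Obs K S) (ho : obsWeight η π bel n o ≠ 0) (a : Fin K) :
    klFin (fun x => (belief P₁ P₂ ρ h n o a x).toReal)
      (fun x => (belief P₁ P₂ ρ h' n o a x).toReal) = kDiv P₁ P₂ h h' (delayState s₀ n o) a := by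
  have ha : a.val < n := a.2.trans_le hn
  rw [belief_eq_nStep η π bel P₁ P₂ ρ h s₀ n o ho a ha,
    belief_eq_nStep η π bel P₁ P₂ ρ h' s₀ n o ho a ha]
  simp only [nStep_toReal]
  unfold kDiv
  split_ifs with h1 h2
  · subst h1
    simp [armLaw, hne.symm]
  · subst h2
    simp [armLaw, hne]
  · simp only [armLaw, h1, h2, if_false]
    exact klFin_self _

include hac in
/-- The mean log-likelihood ratio is bounded by the divergence collected after time `K`. -/
lemma exists_ofReal_obsMean_le (ρ : Fin K → PMF S) (s₀ : DState K S) :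
    ∃ C : ℝ≥0∞, C ≠ ∞ ∧ ∀ (η : Set.Ioc (0 : ℝ) 1) (π : Policy K S) (h h' : Fin K), h' ≠ h →
      ∀ n, ENNReal.ofReal (obsMean η π (belief P₁ P₂ ρ h) (K + n)
        (logRatio π (belief P₁ P₂ ρ h) (belief P₁ P₂ ρ h') (K + n))) ≤
      C + ∑' s, ∑ b, policyOcc η P₁ P₂ ρ h π s₀ s b *
        ∑ a, tremble η b a * ENNReal.ofReal (kDiv P₁ P₂ h h' s a) := by
  classical
  obtain ⟨β, hβ0, hβ1, hβ⟩ := exists_pow_le_belief (P₁ := P₁) (P₂ := P₂) ρ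
  -- One bounded relative entropy for each of the `K` initial observations.
  refine ⟨K * ENNReal.ofReal (-Real.log (β ^ K).toReal),
    ENNReal.mul_ne_top (ENNReal.natCast_ne_top K) ENNReal.ofReal_ne_top,
    fun η π h h' hne n => ?_⟩
  refine (ofReal_obsMean_logRatio_le η π _ _ (K + n)).trans ?_
  rw [Finset.sum_range_add]
  refine add_le_add ?_ ?_
  · refine (Finset.sum_le_card_nsmul _ _ (ENNReal.ofReal (-Real.log (β ^ K).toReal))
      fun t ht => ?_).trans (by simp)
    have htK : t + 1 ≤ K := by simpa using ht
    calc _ ≤ obsExp η π (belief P₁ P₂ ρ h) t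
          fun _ => ENNReal.ofReal (-Real.log (β ^ K).toReal) := by
          refine obsExp_mono _ _ _ _ fun o _ => ?_
          split_ifs
          · have hctrl : ∑ b, ∑ a, controlLaw η π t o (b, a) = 1 := by
              rw [← Fintype.sum_prod_type' fun b a => controlLaw η π t o (b, a)]
              exact sum_pmf _
            calc _ ≤ ∑ b, ∑ a, controlLaw η π t o (b, a) *
                  ENNReal.ofReal (-Real.log (β ^ K).toReal) := by
                  refine Finset.sum_le_sum fun b _ => Finset.sum_le_sum fun a _ =>
                    mul_le_mul_right (ENNReal.ofReal_le_ofReal (klFin_le _ _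
                      (pow_ne_zero K hβ0) fun y hy => ?_)) _
                  exact (pow_le_pow_of_le_one zero_le hβ1 htK).trans
                    (hβ h' t o a y (belief_ne_zero hac ρ h h' t o a y hy))
              _ = _ := by simp only [← Finset.sum_mul, hctrl, one_mul]
          · exact zero_le
      _ = _ := by
          simp only [obsExp, ← Finset.sum_mul]
          have := obsExp_one η π (belief P₁ P₂ ρ h) t
          simp only [obsExp, mul_one] at this
          rw [this, one_mul]
  · rw [tsum_policyOcc_mul η P₁ P₂ ρ h π s₀ fun s b =>
      ∑ a, tremble η b a * ENNReal.ofReal (kDiv P₁ P₂ h h' s a)]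
    refine le_trans (Finset.sum_le_sum fun t _ => ?_) (ENNReal.sum_le_tsum (Finset.range n))
    refine obsExp_mono _ _ _ _ fun o ho => ?_
    split_ifs
    · refine Finset.sum_le_sum fun b _ => ?_
      rw [Finset.mul_sum]
      refine Finset.sum_le_sum fun a _ => ?_
      rw [controlLaw_of_ge η π (by omega),
        klFin_belief η π _ ρ hne s₀ (by omega) o ho a, mul_assoc]
    · exact le_rfl

include hac in
/-- The divergence collected by a policy with error probability at most `ε` is at least of order
`log (1 / ε)`. -/
lemma exists_log_le_occupation (ρ : Fin K → PMF S) (s₀ : DState K S) :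
    ∃ C : ℝ≥0∞, C ≠ ∞ ∧ ∀ (η : Set.Ioc (0 : ℝ) 1) (ε : ℝ), 0 < ε → ε < 1 →
      ∀ π ∈ goodPolicies η P₁ P₂ ρ ε, ∀ h h' : Fin K, h' ≠ h →
      expStopTime η P₁ P₂ ρ h π ≠ ∞ →
      ENNReal.ofReal (Real.log (1 / ε) * (1 - ε) - 1) ≤
      C + ∑' s, ∑ b, policyOcc η P₁ P₂ ρ h π s₀ s b *
        ∑ a, tremble η b a * ENNReal.ofReal (kDiv P₁ P₂ h h' s a) := by
  classical
  obtain ⟨C, hC, hbound⟩ := exists_ofReal_obsMean_le hac ρ s₀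
  refine ⟨C, hC, fun η ε hε hε1 π hπ h h' hne hfin => ?_⟩
  have hlog : 0 ≤ Real.log (1 / ε) := Real.log_nonneg (by rw [le_div_iff₀ hε]; linarith)
  set p : ℕ → ℝ≥0∞ := fun n => obsExp η π (belief P₁ P₂ ρ h) (K + n)
    fun o => if declared π (K + n) o = none then 1 else 0 with hp
  -- A finite expected stopping time makes the tail probabilities summable, so the probability of
  -- not yet having declared tends to zero.
  have hp0 : Filter.Tendsto p Filter.atTop (𝓝 0) := by
    have h1 := ENNReal.tendsto_atTop_zero_of_tsum_ne_top
      (ne_top_of_le_ne_top hfin (tsum_live_le_expStopTime η P₁ P₂ ρ h π))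
    have h2 : ∀ n, obsExp η π (belief P₁ P₂ ρ h) (n + 1)
        (fun o => if declared π (n + 1) o = none then 1 else 0) =
        obsExp η π (belief P₁ P₂ ρ h) n (fun o => if Live π n o then 1 else 0) := by
      intro n
      rw [← obsExp_init η π _ n fun o => if Live π n o then 1 else 0]
      refine Finset.sum_congr rfl fun o _ => ?_
      have := declared_snoc_eq_none π n (Fin.init o) (o (Fin.last n))
      rw [Fin.snoc_init_self] at this
      simp only [this]
    rw [← Filter.tendsto_add_atTop_iff_nat 1]
    have h3 : ∀ n, p (n + 1) =
        obsExp η π (belief P₁ P₂ ρ h) (n + K) (fun o => if Live π (n + K) o then 1 else 0) := by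
      intro n
      rw [hp, add_comm n K]
      exact h2 (K + n)
    simp only [h3]
    exact (Filter.tendsto_add_atTop_iff_nat K).2 h1
  have hp1 : ∀ n, p n ≠ ∞ := fun n => ne_top_of_le_ne_top ENNReal.one_ne_top <|
    obsExp_le_one _ _ _ _ fun o => by split_ifs <;> simp
  have hlow : ∀ n, ENNReal.ofReal (Real.log (1 / ε) * (1 - ε - (p n).toReal) - 1) ≤
      C + ∑' s, ∑ b, policyOcc η P₁ P₂ ρ h π s₀ s b *
        ∑ a, tremble η b a * ENNReal.ofReal (kDiv P₁ P₂ h h' s a) := by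
    intro n
    set E := obsExp η π (belief P₁ P₂ ρ h) (K + n)
      (fun o => if declared π (K + n) o = some h then 1 else 0) with hE
    have hE1 : E ≠ ∞ := ne_top_of_le_ne_top ENNReal.one_ne_top <|
      obsExp_le_one _ _ _ _ fun o => by split_ifs <;> simp
    -- By time `K + n` the policy has declared `h`, declared another index, or declared nothing.
    have hsplit : 1 ≤ E + p n + ENNReal.ofReal ε := by
      refine le_trans ?_ (add_le_add_right
        ((obsExp_declared_le_errorProb η P₁ P₂ ρ h π (K + n)).trans (hπ h)) _)
      rw [hE, hp, ← obsExp_add, ← obsExp_add]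
      refine one_le_obsExp _ _ _ _ fun o => ?_
      rcases hd : declared π (K + n) o with _ | θ
      · simp
      · by_cases hθ : θ = h
        · simp [hθ]
        · simp [hθ]
    have hreal : 1 - ε - (p n).toReal ≤ E.toReal := by
      have := ENNReal.toReal_mono (by simp [hE1, hp1]) hsplit
      rw [ENNReal.toReal_add (by simp [hE1, hp1]) ENNReal.ofReal_ne_top,
        ENNReal.toReal_add hE1 (hp1 n), ENNReal.toReal_one, ENNReal.toReal_ofReal hε.le] at this
      linarith
    have herr : obsExp η π (belief P₁ P₂ ρ h') (K + n)
        (fun o => if declared π (K + n) o = some h then 1 else 0) ≤ ENNReal.ofReal ε := by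
      refine le_trans ?_ ((obsExp_declared_le_errorProb η P₁ P₂ ρ h' π (K + n)).trans (hπ h'))
      refine obsExp_mono _ _ _ _ fun o _ => ?_
      split_ifs with h1 h2
      · exact le_rfl
      · exact absurd ⟨h, hne.symm, h1⟩ h2
      · exact zero_le_one
      · exact le_rfl
    have h1 := le_obsMean_logRatio η π (bel := belief P₁ P₂ ρ h)
      (fun n o c y => belief_ne_zero hac ρ h h' n o c y) (K + n) h hε herr
    refine le_trans (ENNReal.ofReal_le_ofReal ?_) (hbound η π h h' hne n)
    refine le_trans ?_ h1
    have := mul_le_mul_of_nonneg_left hreal hlog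
    linarith
  refine le_of_tendsto' (x := Filter.atTop) ?_ hlow
  refine ENNReal.tendsto_ofReal ?_
  have h2 : Filter.Tendsto (fun n => (p n).toReal) Filter.atTop (𝓝 0) := by
    simpa [Function.comp_def] using (ENNReal.tendsto_toReal ENNReal.zero_ne_top).comp hp0
  have h3 := ((h2.const_sub (1 - ε)).const_mul (Real.log (1 / ε))).sub_const 1
  simpa using h3

-- The case of an infinite expectation is kept apart because `Rstar * ∞` would be `0` if `Rstar`
-- vanished.
include hac in
lemma exists_log_le_Rstar_mul (hP₁ : IsErgodicChain P₁) (hP₂ : IsErgodicChain P₂)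
    (hK : 2 ≤ K) (ρ : Fin K → PMF S) (η : Set.Ioc (0 : ℝ) 1) (h : Fin K) :
    ∃ C : ℝ, ∀ ε : ℝ, 0 < ε → ε < 1 → ∀ π ∈ goodPolicies η P₁ P₂ ρ ε,
      ENNReal.ofReal (Real.log (1 / ε) * (1 - ε) - C) ≤
        Rstar η P₁ P₂ h * expStopTime η P₁ P₂ ρ h π ∨ expStopTime η P₁ P₂ ρ h π = ∞ := by
  classical
  have hS : Nonempty S := ⟨(ρ h).support_nonempty.choose⟩
  obtain ⟨s₀⟩ := DState.exists_state (S := S) h.pos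
  obtain ⟨C₁, hC₁, hlog⟩ := exists_log_le_occupation hac ρ s₀
  obtain ⟨N, β, hβ0, hβ1, hb⟩ := IsErgodicChain.exists_armLaw_bounds (K := K) hP₁ hP₂
  have hη : ENNReal.ofReal ((η : ℝ) / K) ≠ 0 := by
    have hη := η.2.1
    have hK : (0 : ℝ) < K := by exact_mod_cast h.pos
    simpa using by positivity
  set δ := (ENNReal.ofReal ((η : ℝ) / K) * β) ^ (N + K) with hδ
  have hδ0 : δ ≠ 0 := pow_ne_zero _ (mul_ne_zero hη hβ0)
  set G := ENNReal.ofReal (-Real.log β.toReal) with hG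
  set C₂ := C₁ + ↑(N + K) * (G * δ⁻¹) with hC₂
  have hC₂t : C₂ ≠ ∞ := ENNReal.add_ne_top.2 ⟨hC₁, ENNReal.mul_ne_top (ENNReal.natCast_ne_top _)
    (ENNReal.mul_ne_top ENNReal.ofReal_ne_top (ENNReal.inv_ne_top.2 hδ0))⟩
  refine ⟨1 + C₂.toReal, fun ε hε hε1 π hπ => ?_⟩
  by_cases hfin : expStopTime η P₁ P₂ ρ h π = ∞
  · exact Or.inr hfin
  left
  set T := ∑' s, ∑ b, policyOcc η P₁ P₂ ρ h π s₀ s b with hT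
  have hTle : T ≤ expStopTime η P₁ P₂ ρ h π := tsum_sum_policyOcc_le η P₁ P₂ ρ h π s₀
  have hTt : T ≠ ∞ := ne_top_of_le_ne_top hfin hTle
  have : Nonempty (Fin K) := ⟨h⟩
  -- The strategy is chosen before `h'`, so the estimates for all alternatives concern the same
  -- `lam`.
  obtain ⟨lam, hlam⟩ := exists_conditional (policyOcc η P₁ P₂ ρ h π s₀) fun s =>
    ne_top_of_le_ne_top hTt (ENNReal.le_tsum s)
  obtain ⟨x₀, hx₀⟩ := exists_forall_le_kerPow (η := η) (lam := lam) (fun c => (hb h c).2)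
    (fun c => (hb h c).1) h.pos
  obtain ⟨hμ1, hμ⟩ := isStationary_stationaryDist η hP₁ hP₂ h lam
  have hmain : ∀ h', h' ≠ h → ENNReal.ofReal (Real.log (1 / ε) * (1 - ε) - (1 + C₂.toReal)) ≤
      T * ∑' s, ∑ a, occupancy η P₁ P₂ h lam s a * ENNReal.ofReal (kDiv P₁ P₂ h h' s a) := by
    intro h' hne
    have h1 := hlog η ε hε hε1 π hπ h h' hne hfin
    have h2 : ∑' s, ∑ b, policyOcc η P₁ P₂ ρ h π s₀ s b *
        ∑ a, tremble η b a * ENNReal.ofReal (kDiv P₁ P₂ h h' s a) =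
        ∑' s, (∑ b, policyOcc η P₁ P₂ ρ h π s₀ s b) *
          ∑ a, pullProb η lam s a * ENNReal.ofReal (kDiv P₁ P₂ h h' s a) := by
      refine tsum_congr fun s => ?_
      simp only [Finset.mul_sum, ← mul_assoc]
      rw [Finset.sum_comm]
      refine Finset.sum_congr rfl fun a _ => ?_
      rw [← Finset.sum_mul, ← mul_pullProb_eq η lam hlam]
    have h3 : ∀ s, ∑ a, pullProb η lam s a * ENNReal.ofReal (kDiv P₁ P₂ h h' s a) ≤ G := by
      intro s
      calc _ ≤ ∑ a, pullProb η lam s a * G := Finset.sum_le_sum fun a _ =>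
            mul_le_mul_right (ENNReal.ofReal_le_ofReal
              (kDiv_le hac hβ0 hβ1 (fun h c => (hb h c).2) hne s a)) _
        _ = G := by rw [← Finset.sum_mul, sum_pullProb η h.pos, one_mul]
    have h4 := tsum_mul_le_stationary (tsum_delayKer η P₁ P₂ h h.pos lam) hδ0 hx₀ hμ1 hμ hTt
      (sum_policyOcc_le η P₁ P₂ ρ h π s₀ lam hlam)
      (e := fun s' => obsExp η π (belief P₁ P₂ ρ h) K
        fun o => if delayState s₀ K o = s' then 1 else 0) (by
        simp only [obsExp]
        rw [Summable.tsum_finsetSum fun _ _ => ENNReal.summable]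
        simp only [ENNReal.tsum_mul_left]
        refine obsExp_le_one η π _ K fun o => ?_
        rw [tsum_eq_single (delayState s₀ K o) fun s hs => if_neg hs.symm]
        simp) ENNReal.ofReal_ne_top h3
    rw [h2] at h1
    have h5 : ENNReal.ofReal (Real.log (1 / ε) * (1 - ε) - 1) ≤ T * (∑' s, ∑ a,
        occupancy η P₁ P₂ h lam s a * ENNReal.ofReal (kDiv P₁ P₂ h h' s a)) + C₂ := by
      refine (h1.trans (add_le_add_right h4 C₁)).trans (le_of_eq ?_)
      simp only [occupancy, mul_assoc, ← Finset.mul_sum]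
      rw [hC₂, hT]
      ring
    rw [← sub_sub, ENNReal.ofReal_sub _ ENNReal.toReal_nonneg, ENNReal.ofReal_toReal hC₂t]
    exact tsub_le_iff_right.2 h5
  refine le_trans ?_ (mul_le_mul_right hTle _)
  -- If `T = 0`, any alternative `h'` forces the left side to be zero; otherwise one may divide by
  -- `T` and pass to the supremum over strategies.
  rcases eq_or_ne T 0 with hT0 | hT0
  · have : Nontrivial (Fin K) := Fin.nontrivial_iff_two_le.2 hK
    obtain ⟨h', hne⟩ := exists_ne h
    have := hmain h' hne
    rw [hT0, zero_mul] at this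
    exact this.trans zero_le
  · rw [← ENNReal.div_le_iff hT0 hTt]
    refine le_trans ?_ (le_iSup (fun lam : SRS K S => ⨅ (h' : Fin K) (_ : h' ≠ h),
      ∑' s, ∑ a, occupancy η P₁ P₂ h lam s a * ENNReal.ofReal (kDiv P₁ P₂ h h' s a)) lam)
    refine le_iInf₂ fun h' hne => ?_
    rw [ENNReal.div_le_iff hT0 hTt, mul_comm _ T]
    exact hmain h' hne

end LowerBound

end

end OddArm

/-! ### The limit of small error probability -/

theorem mainTheorem2 {S : Type*} [Fintype S] [DecidableEq S] (K : ℕ) (hK : 3 ≤ K)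
    (P₁ P₂ : S → PMF S) (hP₁ : OddArm.IsErgodicChain P₁) (hP₂ : OddArm.IsErgodicChain P₂)
    (hne : P₁ ≠ P₂) (hac : ∀ i j, 0 < P₁ i j ↔ 0 < P₂ i j)
    (ρ : Fin K → PMF S) (η : Set.Ioc (0 : ℝ) 1) (h : Fin K) :
    1 / OddArm.Rstar η P₁ P₂ h ≤
      Filter.liminf (fun ε : ℝ => ⨅ π ∈ OddArm.goodPolicies η P₁ P₂ ρ ε,
        OddArm.expStopTime η P₁ P₂ ρ h π / ENNReal.ofReal (Real.log (1 / ε))) (𝓝[>] 0) := by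
  obtain ⟨C, hC⟩ := OddArm.exists_log_le_Rstar_mul hac hP₁ hP₂ (by omega) ρ η h
  have hlogtop : Filter.Tendsto (fun ε : ℝ => Real.log (1 / ε)) (𝓝[>] 0) Filter.atTop := by
    simp only [one_div]
    exact Real.tendsto_log_atTop.comp tendsto_inv_nhdsGT_zero
  have hlim : Filter.Tendsto (fun ε : ℝ => ENNReal.ofReal (1 - ε - C / Real.log (1 / ε)) /
      OddArm.Rstar η P₁ P₂ h) (𝓝[>] 0) (𝓝 (1 / OddArm.Rstar η P₁ P₂ h)) := by
    simp only [div_eq_mul_inv _ (OddArm.Rstar η P₁ P₂ h)]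
    -- The limit `1` of the numerator is nonzero, so the product converges even if the inverse of
    -- `Rstar` is infinite.
    refine ENNReal.Tendsto.mul_const ?_ (Or.inl one_ne_zero)
    rw [← ENNReal.ofReal_one]
    refine ENNReal.tendsto_ofReal ?_
    have h1 : Filter.Tendsto (fun ε : ℝ => ε) (𝓝[>] 0) (𝓝 0) := nhdsWithin_le_nhds
    simpa using (h1.const_sub 1).sub (hlogtop.const_div_atTop C)
  rw [← hlim.liminf_eq]
  refine Filter.liminf_le_liminf ?_
  filter_upwards [hlogtop.eventually_gt_atTop 0, self_mem_nhdsWithin,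
    nhdsWithin_le_nhds (Iio_mem_nhds (zero_lt_one (α := ℝ)))] with ε hlog hε hε1
  refine le_iInf₂ fun π hπ => ?_
  rcases hC ε hε hε1 π hπ with h1 | h1
  · refine ENNReal.div_le_of_le_mul ?_
    rw [mul_comm, ← mul_div_assoc]
    rw [ENNReal.le_div_iff_mul_le (Or.inl (by simpa using hlog)) (Or.inl ENNReal.ofReal_ne_top),
      ← ENNReal.ofReal_mul' hlog.le]
    refine le_trans (ENNReal.ofReal_le_ofReal (le_of_eq ?_)) h1
    field_simp
  · rw [h1, ENNReal.top_div_of_ne_top ENNReal.ofReal_ne_top]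
    exact le_top
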